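/- Let $M$ and $N$ be smooth ($C^\infty$) manifolds without boundary (Hausdorff, second countable, finite-dimensional, not assumed connected, compact or of the same dimension). For a smooth manifold $X$ and an integer $k\ge 0$ let $\Omega^k(X)$ be the space of smooth real-valued differential $k$-forms on $X$ (with $\Omega^{-1}(X)=0$), $d$ the exterior derivative, and put \[Z^k(X)=\ker\big(d:\Omega^k(X)\to\Omega^{k+1}(X)\big),\qquad B^k(X)=\operatorname{im}\big(d:\Omega^{k-1}(X)\to\Omega^k(X)\big),\] \[\overline{Z}^k(X)=\{\lambda\in Z^k(X) : \text{there are a compact } K\subseteq X \text{ and } \nu\in\Omega^{k-1}(X\setminus K) \text{ with } d\nu=\lambda|_{X\setminus K}\},\] so that $B^k(X)\subseteq\overline{Z}^k(X)$, and \[c_k(X)=\dim_{\mathbb R}\,\overline{Z}^k(X)/B^k(X),\] a possibly infinite cardinal. If $M$ and $N$ are homeomorphic, then $c_k(M)=c_k(N)$ for every integer $k\ge 0$. -/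

import Mathlib

open scoped Manifold ContDiff Topology

noncomputable section

namespace DiffForm

variable (E : Type*) [NormedAddCommGroup E] [NormedSpace ℝ E]
  (M : Type*) [TopologicalSpace M] [ChartedSpace E M]

/-- Not necessarily smooth (nor continuous) real `k`-forms on a manifold `M` modelled on `E`:
at each point, an alternating `k`-linear form on the tangent space. -/
def RawForm (k : ℕ) : Type _ :=
  ∀ x : M, TangentSpace 𝓘(ℝ, E) x [⋀^Fin k]→L[ℝ] ℝ

variable {E M} {k : ℕ}

/-- Forms are added and scaled pointwise. -/
instance : AddCommGroup (RawForm E M k) :=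
  inferInstanceAs (AddCommGroup (∀ x : M, TangentSpace 𝓘(ℝ, E) x [⋀^Fin k]→L[ℝ] ℝ))

instance : Module ℝ (RawForm E M k) :=
  inferInstanceAs (Module ℝ (∀ x : M, TangentSpace 𝓘(ℝ, E) x [⋀^Fin k]→L[ℝ] ℝ))

lemma add_apply (θ η : RawForm E M k) (x : M) : (θ + η) x = θ x + η x := rfl

lemma smul_apply (r : ℝ) (θ : RawForm E M k) (x : M) : (r • θ) x = r • θ x := rfl

lemma zero_apply (x : M) : (0 : RawForm E M k) x = 0 := rfl

/-- The expression of `θ` in the chart `φ`, i.e. the pullback of `θ` by `φ⁻¹`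
(meaningful on `φ.target`). -/
def inChart (φ : OpenPartialHomeomorph M E) (θ : RawForm E M k) (y : E) :
    E [⋀^Fin k]→L[ℝ] ℝ :=
  (θ (φ.symm y)).compContinuousLinearMap
    (mfderiv 𝓘(ℝ, E) 𝓘(ℝ, E) φ.symm y : E →L[ℝ] TangentSpace 𝓘(ℝ, E) (φ.symm y))

/-- `θ` is smooth on the open set `U`: all its chart expressions are. -/
def IsSmoothOn (U : Set M) (θ : RawForm E M k) : Prop :=
  ∀ φ ∈ atlas E M, ContDiffOn ℝ ∞ (inChart φ θ) (φ.target ∩ φ.symm ⁻¹' U)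

/-- The exterior derivative, computed at `x` in the preferred chart at `x`
(see `inChart_d` for the independence of the chart). -/
def d (θ : RawForm E M k) : RawForm E M (k + 1) := fun x =>
  (extDeriv (inChart (chartAt E x) θ) (chartAt E x x)).compContinuousLinearMap
    (mfderiv 𝓘(ℝ, E) 𝓘(ℝ, E) (chartAt E x) x : TangentSpace 𝓘(ℝ, E) x →L[ℝ] E)

/-- `θ` is exact on the open set `U`: it is `dν` there, for some smooth `(k-1)`-form `ν` on `U`
(the values of `ν` off `U` are irrelevant). There are no nonzero forms of degree `-1`, so a
`0`-form is exact on `U` when it vanishes there. -/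
def IsExactOn (U : Set M) : {k : ℕ} → RawForm E M k → Prop
  | 0, θ => ∀ x ∈ U, θ x = 0
  | _ + 1, θ => ∃ ν : RawForm E M _, IsSmoothOn U ν ∧ ∀ x ∈ U, d ν x = θ x

/-! ### Linearity -/

lemma inChart_add (φ : OpenPartialHomeomorph M E) (θ η : RawForm E M k) :
    inChart φ (θ + η) = inChart φ θ + inChart φ η := rfl

lemma inChart_smul (φ : OpenPartialHomeomorph M E) (c : ℝ) (θ : RawForm E M k) :
    inChart φ (c • θ) = c • inChart φ θ := rfl

lemma inChart_zero (φ : OpenPartialHomeomorph M E) :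
    inChart φ (0 : RawForm E M k) = 0 := rfl

lemma IsSmoothOn.zero (U : Set M) : IsSmoothOn U (0 : RawForm E M k) := by
  intro φ _
  rw [inChart_zero]
  exact contDiffOn_const

lemma IsSmoothOn.add {U : Set M} {θ η : RawForm E M k} (hθ : IsSmoothOn U θ)
    (hη : IsSmoothOn U η) : IsSmoothOn U (θ + η) := by
  intro φ hφ
  rw [inChart_add]
  exact (hθ φ hφ).add (hη φ hφ)

lemma IsSmoothOn.smul {U : Set M} {θ : RawForm E M k} (c : ℝ) (hθ : IsSmoothOn U θ) :
    IsSmoothOn U (c • θ) := by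
  intro φ hφ
  rw [inChart_smul]
  exact (hθ φ hφ).const_smul c

lemma IsSmoothOn.mono {U V : Set M} {θ : RawForm E M k} (hθ : IsSmoothOn U θ) (h : V ⊆ U) :
    IsSmoothOn V θ := fun φ hφ =>
  (hθ φ hφ).mono (Set.inter_subset_inter_right _ (Set.preimage_mono h))

lemma IsSmoothOn.contDiffAt {U : Set M} (hU : IsOpen U) {θ : RawForm E M k}
    (hθ : IsSmoothOn U θ) {φ : OpenPartialHomeomorph M E} (hφ : φ ∈ atlas E M)
    {y : E} (hy : y ∈ φ.target) (hyU : φ.symm y ∈ U) : ContDiffAt ℝ ∞ (inChart φ θ) y :=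
  (hθ φ hφ).contDiffAt ((φ.isOpen_inter_preimage_symm hU).mem_nhds ⟨hy, hyU⟩)

lemma IsSmoothOn.differentiableAt {U : Set M} (hU : IsOpen U) {θ : RawForm E M k}
    (hθ : IsSmoothOn U θ) {x : M} (hx : x ∈ U) :
    DifferentiableAt ℝ (inChart (chartAt E x) θ) (chartAt E x x) :=
  (hθ.contDiffAt hU (chart_mem_atlas E x) (mem_chart_target E x)
    (by simpa using hx)).differentiableAt (by simp)

lemma d_zero : d (0 : RawForm E M k) = 0 := by
  funext x
  have h : extDeriv (0 : E → E [⋀^Fin k]→L[ℝ] ℝ) (chartAt E x x) = 0 := by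
    simpa using extDeriv_smul (0 : ℝ) (0 : E → E [⋀^Fin k]→L[ℝ] ℝ) (x := chartAt E x x)
  simp only [d, inChart_zero, h]
  rfl

lemma d_smul (c : ℝ) (θ : RawForm E M k) : d (c • θ) = c • d θ := by
  funext x
  simp only [d, inChart_smul, extDeriv_smul]
  rfl

lemma d_add {U : Set M} (hU : IsOpen U) {θ η : RawForm E M k} (hθ : IsSmoothOn U θ)
    (hη : IsSmoothOn U η) {x : M} (hx : x ∈ U) : d (θ + η) x = d θ x + d η x := by
  simp only [d, inChart_add]
  rw [extDeriv_add (hθ.differentiableAt hU hx) (hη.differentiableAt hU hx)]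
  rfl

lemma IsExactOn.zero (U : Set M) : ∀ {k : ℕ}, IsExactOn U (0 : RawForm E M k)
  | 0 => fun _ _ => rfl
  | _ + 1 => ⟨0, .zero U, fun x _ => by rw [d_zero]⟩

lemma IsExactOn.add {U : Set M} (hU : IsOpen U) : ∀ {k : ℕ} {θ η : RawForm E M k},
    IsExactOn U θ → IsExactOn U η → IsExactOn U (θ + η)
  | 0, _, _, hθ, hη => fun x hx => by rw [add_apply, hθ x hx, hη x hx, add_zero]
  | _ + 1, _, _, ⟨α, hα, hα'⟩, ⟨β, hβ, hβ'⟩ => ⟨α + β, hα.add hβ, fun x hx => by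
      rw [d_add hU hα hβ hx, hα' x hx, hβ' x hx, add_apply]⟩

lemma IsExactOn.smul {U : Set M} (c : ℝ) : ∀ {k : ℕ} {θ : RawForm E M k},
    IsExactOn U θ → IsExactOn U (c • θ)
  | 0, _, hθ => fun x hx => by rw [smul_apply, hθ x hx, smul_zero]
  | _ + 1, _, ⟨α, hα, hα'⟩ => ⟨c • α, hα.smul c, fun x hx => by
      rw [d_smul, smul_apply, hα' x hx, smul_apply]⟩

lemma IsExactOn.mono {U V : Set M} (h : V ⊆ U) : ∀ {k : ℕ} {θ : RawForm E M k},
    IsExactOn U θ → IsExactOn V θ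
  | 0, _, hθ => fun x hx => hθ x (h hx)
  | _ + 1, _, ⟨α, hα, hα'⟩ => ⟨α, hα.mono h, fun x hx => hα' x (h hx)⟩

/-! ### The spaces of forms and the invariant -/

variable (E M k)

/-- The space `Ω^k(M)` of smooth `k`-forms. -/
def smoothForms : Submodule ℝ (RawForm E M k) where
  carrier := {θ | IsSmoothOn Set.univ θ}
  zero_mem' := .zero _
  add_mem' := .add
  smul_mem' c _ := .smul c

/-- The space `Z^k(M)` of closed smooth `k`-forms. -/
def closedForms : Submodule ℝ (RawForm E M k) where
  carrier := {θ | θ ∈ smoothForms E M k ∧ d θ = 0}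
  zero_mem' := ⟨zero_mem _, d_zero⟩
  add_mem' := fun {a b} ha hb => ⟨add_mem ha.1 hb.1, by
    funext x
    rw [d_add isOpen_univ ha.1 hb.1 (Set.mem_univ x), ha.2, hb.2]
    exact add_zero _⟩
  smul_mem' c _ h := ⟨Submodule.smul_mem _ c h.1, by rw [d_smul, h.2, smul_zero]⟩

/-- The space `B^k(M)` of exact `k`-forms, the image of `d` on smooth `(k-1)`-forms
(zero for `k = 0`). -/
def exactForms : Submodule ℝ (RawForm E M k) where
  carrier := {θ | IsExactOn Set.univ θ}
  zero_mem' := .zero _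
  add_mem' := .add isOpen_univ
  smul_mem' c _ := .smul c

/-- The space of closed `k`-forms on `M` that are exact on the complement of some compact set. -/
def closedFormsExactAtInfinity [T2Space M] : Submodule ℝ (RawForm E M k) where
  carrier := {θ | θ ∈ closedForms E M k ∧ ∃ K : Set M, IsCompact K ∧ IsExactOn Kᶜ θ}
  zero_mem' := ⟨zero_mem _, ∅, isCompact_empty, .zero _⟩
  add_mem' := by
    rintro a b ⟨ha, K, hK, ha'⟩ ⟨hb, L, hL, hb'⟩
    exact ⟨add_mem ha hb, K ∪ L, hK.union hL, .add (hK.union hL).isClosed.isOpen_compl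
      (ha'.mono (Set.compl_subset_compl.2 Set.subset_union_left))
      (hb'.mono (Set.compl_subset_compl.2 Set.subset_union_right))⟩
  smul_mem' := by
    rintro c a ⟨ha, K, hK, ha'⟩
    exact ⟨Submodule.smul_mem _ c ha, K, hK, ha'.smul c⟩

/-- The quotient of the closed `k`-forms that are exact outside a compact set by the exact
`k`-forms (which are among them: `exactForms_le`). -/
abbrev CohomologyExactAtInfinity [T2Space M] : Type _ :=
  closedFormsExactAtInfinity E M k ⧸
    (exactForms E M k).submoduleOf (closedFormsExactAtInfinity E M k)

/-- The invariant `c_k(M)`, the dimension of the above quotient, as a cardinal. -/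
def c [T2Space M] : Cardinal :=
  Module.rank ℝ (CohomologyExactAtInfinity E M k)

/-! ### Independence of the chart, and `d ∘ d = 0` -/

variable {E M k}

variable [IsManifold 𝓘(ℝ, E) ∞ M]

lemma two_le_infty : (2 : ℕ∞ω) ≤ ∞ := WithTop.coe_le_coe.2 (le_top (a := (2 : ℕ∞)))

lemma mdiff_chart {φ : OpenPartialHomeomorph M E} (hφ : φ ∈ atlas E M) {x : M}
    (hx : x ∈ φ.source) : MDifferentiableAt 𝓘(ℝ, E) 𝓘(ℝ, E) φ x :=
  (contMDiffAt_of_mem_maximalAtlas (n := ∞)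
    (IsManifold.subset_maximalAtlas hφ) hx).mdifferentiableAt (by simp)

lemma mdiff_chart_symm {φ : OpenPartialHomeomorph M E} (hφ : φ ∈ atlas E M) {y : E}
    (hy : y ∈ φ.target) : MDifferentiableAt 𝓘(ℝ, E) 𝓘(ℝ, E) φ.symm y :=
  (contMDiffAt_symm_of_mem_maximalAtlas (n := ∞)
    (IsManifold.subset_maximalAtlas hφ) hy).mdifferentiableAt (by simp)

lemma inChart_eq (θ : RawForm E M k) {φ ψ : OpenPartialHomeomorph M E}
    (hφ : φ ∈ atlas E M) (hψ : ψ ∈ atlas E M) {y : E} (hy : y ∈ φ.target)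
    (hy' : φ.symm y ∈ ψ.source) :
    inChart φ θ y =
      (inChart ψ θ ((ψ ∘ φ.symm) y)).compContinuousLinearMap (fderiv ℝ (ψ ∘ φ.symm) y) := by
  have hT : MDifferentiableAt 𝓘(ℝ, E) 𝓘(ℝ, E) (ψ ∘ φ.symm) y :=
    (mdiff_chart hψ hy').comp y (mdiff_chart_symm hφ hy)
  have hT' : (ψ ∘ φ.symm) y ∈ ψ.target := ψ.map_source hy'
  have hev : φ.symm =ᶠ[𝓝 y] ψ.symm ∘ (ψ ∘ φ.symm) := by
    filter_upwards [φ.symm.continuousAt hy (ψ.open_source.mem_nhds hy')] with z hz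
    exact (ψ.left_inv hz).symm
  have hD : (mfderiv 𝓘(ℝ, E) 𝓘(ℝ, E) φ.symm y : E →L[ℝ] E) =
      (mfderiv 𝓘(ℝ, E) 𝓘(ℝ, E) ψ.symm ((ψ ∘ φ.symm) y) : E →L[ℝ] E).comp
        (fderiv ℝ (ψ ∘ φ.symm) y) := by
    have h1 := hev.mfderiv_eq (I := 𝓘(ℝ, E)) (I' := 𝓘(ℝ, E))
    have h2 := mfderiv_comp y (mdiff_chart_symm hψ hT') hT
    rw [mfderiv_eq_fderiv] at h2
    exact h1.trans h2
  have hp : ψ.symm ((ψ ∘ φ.symm) y) = φ.symm y := ψ.left_inv hy'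
  let θ' : M → E [⋀^Fin k]→L[ℝ] ℝ := θ
  change (θ' (φ.symm y)).compContinuousLinearMap
      (mfderiv 𝓘(ℝ, E) 𝓘(ℝ, E) φ.symm y : E →L[ℝ] E) =
    ((θ' (ψ.symm ((ψ ∘ φ.symm) y))).compContinuousLinearMap
      (mfderiv 𝓘(ℝ, E) 𝓘(ℝ, E) ψ.symm ((ψ ∘ φ.symm) y) : E →L[ℝ] E)).compContinuousLinearMap
        (fderiv ℝ (ψ ∘ φ.symm) y)
  rw [hD, hp]
  rfl

/-- In every chart the manifold exterior derivative is the one of the model space. -/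
lemma inChart_d {U : Set M} (hU : IsOpen U) {θ : RawForm E M k} (hθ : IsSmoothOn U θ)
    {φ : OpenPartialHomeomorph M E} (hφ : φ ∈ atlas E M) {y : E} (hy : y ∈ φ.target)
    (hyU : φ.symm y ∈ U) : inChart φ (d θ) y = extDeriv (inChart φ θ) y := by
  set ψ := chartAt E (φ.symm y) with hψdef
  have hψ : ψ ∈ atlas E M := chart_mem_atlas E _
  have hy' : φ.symm y ∈ ψ.source := mem_chart_source E _
  have hT : ContDiffAt ℝ ∞ (ψ ∘ φ.symm) y :=
    ((contMDiffAt_of_mem_maximalAtlas (I := 𝓘(ℝ, E)) (n := ∞)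
      (IsManifold.subset_maximalAtlas hψ) hy').comp y
      (contMDiffAt_symm_of_mem_maximalAtlas (n := ∞)
        (IsManifold.subset_maximalAtlas hφ) hy)).contDiffAt
  have hev : inChart φ θ =ᶠ[𝓝 y] fun z =>
      (inChart ψ θ ((ψ ∘ φ.symm) z)).compContinuousLinearMap (fderiv ℝ (ψ ∘ φ.symm) z) := by
    filter_upwards [φ.open_target.mem_nhds hy,
      φ.symm.continuousAt hy (ψ.open_source.mem_nhds hy')] with z hz hz'
    exact inChart_eq θ hφ hψ hz hz'
  have hD : fderiv ℝ (ψ ∘ φ.symm) y =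
      (mfderiv 𝓘(ℝ, E) 𝓘(ℝ, E) ψ (φ.symm y) : E →L[ℝ] E).comp
        (mfderiv 𝓘(ℝ, E) 𝓘(ℝ, E) φ.symm y : E →L[ℝ] E) := by
    have h2 := mfderiv_comp y (mdiff_chart hψ hy') (mdiff_chart_symm hφ hy)
    rw [mfderiv_eq_fderiv] at h2
    exact h2
  rw [hev.extDeriv_eq, extDeriv_pullback (f := ψ ∘ φ.symm) (r := ∞) (hθ.differentiableAt hU hyU) hT (by simpa using two_le_infty), hD]
  rfl

lemma IsSmoothOn.d {U : Set M} (hU : IsOpen U) {θ : RawForm E M k} (hθ : IsSmoothOn U θ) :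
    IsSmoothOn U (d θ) := by
  intro φ hφ
  refine ContDiffOn.congr (f := extDeriv (inChart φ θ)) ?_
    fun y hy => inChart_d hU hθ hφ hy.1 hy.2
  intro y hy
  refine ContDiffAt.contDiffWithinAt ?_
  have h : ContDiffAt ℝ ∞ (fderiv ℝ (inChart φ θ)) y :=
    (hθ.contDiffAt hU hφ hy.1 hy.2).fderiv_right (by simp)
  exact (ContinuousAlternatingMap.alternatizeUncurryFinCLM ℝ E ℝ).contDiff.contDiffAt.comp y h

lemma d_d {U : Set M} (hU : IsOpen U) {θ : RawForm E M k} (hθ : IsSmoothOn U θ)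
    {x : M} (hx : x ∈ U) : DiffForm.d (DiffForm.d θ) x = 0 := by
  have hφ := chart_mem_atlas E x
  have hy := mem_chart_target E x
  have hyU : (chartAt E x).symm (chartAt E x x) ∈ U := by simpa using hx
  have hev : inChart (chartAt E x) (DiffForm.d θ) =ᶠ[𝓝 (chartAt E x x)]
      extDeriv (inChart (chartAt E x) θ) := by
    filter_upwards [((chartAt E x).isOpen_inter_preimage_symm hU).mem_nhds ⟨hy, hyU⟩] with z hz
    exact inChart_d hU hθ hφ hz.1 hz.2
  have h0 : extDeriv (inChart (chartAt E x) (DiffForm.d θ)) (chartAt E x x) = 0 := by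
    rw [hev.extDeriv_eq]
    exact extDeriv_extDeriv_apply (hθ.contDiffAt hU hφ hy hyU) (by simpa using two_le_infty)
  rw [DiffForm.d, h0]
  rfl

lemma exactForms_le [T2Space M] : exactForms E M k ≤ closedFormsExactAtInfinity E M k := by
  intro θ hθ
  refine ⟨?_, ∅, isCompact_empty, hθ.mono (Set.subset_univ _)⟩
  cases k with
  | zero =>
    obtain rfl : θ = 0 := funext fun x => hθ x trivial
    exact zero_mem _
  | succ k =>
    obtain ⟨ν, hν, hd⟩ := hθ
    obtain rfl : DiffForm.d ν = θ := funext fun x => hd x trivial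
    exact ⟨hν.d isOpen_univ, funext fun x => d_d isOpen_univ hν trivial⟩

end DiffForm

end

universe u v

/-! The quotient in question is the part of de Rham cohomology that dies outside some compact set.
It is shown to be isomorphic to its counterpart in Alexander–Spanier cohomology, which is built from
arbitrary real functions of `k + 1` points, taken up to equality near the diagonal. That counterpart
involves only open and compact sets, so a homeomorphism preserves it. The dimensions of the model
spaces are never compared.

The comparison is Weil's zigzag in a double complex: functions of `p` points with values in
`q`-forms, taken near the diagonal, with the exterior derivative `dC` and the commuting differential
`coboundary`. The form direction is exact by Poincaré's lemma (`exists_dC_eq`), with the constants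
as kernel in degree `0` (`exists_constC_of_dC_eq_zero`). The point direction is exact by partitions
of unity (`exists_coboundary_eq`). In each bidegree one takes the cochains killed by both
differentials modulo those of the form `dC (coboundary β)`. In form degree `0`, where no such `β`
exists, the trivial cochains are the constant ones whose values form a coboundary.

If `dC β = α` and `coboundary β = α'`, then `α` is trivial on an open set exactly when `α'` is
(`IsNullOn.of_zigzag_left`, `IsNullOn.of_zigzag_right`). As this holds over every open set, it holds
on the whole manifold and on the complement of a compact `K`. Hence triviality at infinity is
carried along with the same `K`, and primitives outside `K` never need extending. Each step is a
linear relation, turned into an isomorphism by `nonempty_quotient_equiv_of_relation`. -/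

namespace DiffForm

/-! ### Poincaré's lemma on balls -/

section Poincare

open MeasureTheory Set

universe w

/-- The partial derivative is jointly continuous, hence bounded on the compact product of a closed
unit ball and the interval; that constant dominates. -/
theorem hasFDerivAt_intervalIntegral_of_contDiff {E G : Type*} [NormedAddCommGroup E]
    [NormedSpace ℝ E] [ProperSpace E] [NormedAddCommGroup G] [NormedSpace ℝ G]
    {F : E → ℝ → G} (hF : ContDiff ℝ 1 (Function.uncurry F)) (a b : ℝ) (y : E) :
    HasFDerivAt (fun y => ∫ t in a..b, F y t) (∫ t in a..b, fderiv ℝ (fun z => F z t) y) y := by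
  have hc : Continuous (Function.uncurry F) := hF.continuous
  have hF' : Continuous fun p : E × ℝ => fderiv ℝ (fun z => F z p.2) p.1 := by
    have : ContDiff ℝ 1 (Function.uncurry fun (p : E × ℝ) (z : E) => F z p.2) :=
      hF.comp (contDiff_snd.prodMk (contDiff_snd.comp contDiff_fst))
    exact (this.fderiv (n := 0) contDiff_fst (by simp)).continuous
  obtain ⟨C, hC⟩ := ((isCompact_closedBall y 1).prod isCompact_uIcc
    (s := Metric.closedBall y 1) (t := uIcc a b)).exists_bound_of_continuousOn hF'.continuousOn
  refine (intervalIntegral.hasFDerivAt_integral_of_dominated_of_fderiv_le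
    (F' := fun y t => fderiv ℝ (fun z => F z t) y) (bound := fun _ => C)
    (Metric.closedBall_mem_nhds y one_pos) ?_ ?_ ?_ ?_ ?_ ?_)
  · exact .of_forall fun x =>
      (hc.comp (Continuous.prodMk_right x)).aestronglyMeasurable
  · exact (hc.comp (Continuous.prodMk_right y)).intervalIntegrable _ _
  · exact (hF'.comp (Continuous.prodMk_right y)).aestronglyMeasurable
  · exact .of_forall fun t ht x hx => hC (x, t) ⟨hx, uIoc_subset_uIcc ht⟩
  · exact intervalIntegrable_const
  · refine .of_forall fun t _ x _ => DifferentiableAt.hasFDerivAt ?_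
    exact ((hF.comp (contDiff_id.prodMk contDiff_const)).differentiable
      (by simp) : Differentiable ℝ fun z => F z t) x

/-- Induction on the order of differentiability. The target varies, since the derivative is an
integral of the same kind with values in `E →L[ℝ] G`; a common universe for `E` and `G` keeps that
space within the induction. -/
theorem contDiff_intervalIntegral {E : Type w} [NormedAddCommGroup E] [NormedSpace ℝ E]
    [ProperSpace E] {G : Type w} [NormedAddCommGroup G] [NormedSpace ℝ G]
    {F : E → ℝ → G} (hF : ContDiff ℝ ∞ (Function.uncurry F)) (a b : ℝ) :
    ContDiff ℝ ∞ (fun y => ∫ t in a..b, F y t) := by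
  refine contDiff_infty.2 fun n => ?_
  induction n generalizing G with
  | zero =>
    refine contDiff_zero.2 ?_
    exact intervalIntegral.continuous_parametric_intervalIntegral_of_continuous' hF.continuous a b
  | succ n ih =>
    have h1 := fun y => hasFDerivAt_intervalIntegral_of_contDiff (hF.of_le (by simp)) a b y
    rw [Nat.cast_add, Nat.cast_one, contDiff_succ_iff_fderiv]
    refine ⟨fun y => (h1 y).differentiableAt, by simp, ?_⟩
    rw [funext fun y => (h1 y).fderiv]
    refine ih ?_
    have : ContDiff ℝ ∞ (Function.uncurry fun (p : E × ℝ) (z : E) => F z p.2) :=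
      hF.comp (contDiff_snd.prodMk (contDiff_snd.comp contDiff_fst))
    exact this.fderiv (n := ∞) contDiff_fst (by simp)

variable {E : Type w} [NormedAddCommGroup E] [NormedSpace ℝ E]

/-- The alternatization of the interior product with `w` of a form-valued linear map `L`. -/
theorem alternatizeUncurryFin_curryLeft_comp {q : ℕ} (L : E →L[ℝ] E [⋀^Fin (q + 1)]→L[ℝ] ℝ)
    (w : E) :
    ContinuousAlternatingMap.alternatizeUncurryFin
      ((ContinuousLinearMap.apply ℝ (E [⋀^Fin q]→L[ℝ] ℝ) w).comp
        ((ContinuousAlternatingMap.curryLeftLI (𝕜 := ℝ) (E := E) (F := ℝ)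
          (n := q)).toContinuousLinearMap.comp L)) =
      L w - (ContinuousAlternatingMap.alternatizeUncurryFin L).curryLeft w := by
  ext v
  rw [ContinuousAlternatingMap.alternatizeUncurryFin_apply, ContinuousAlternatingMap.sub_apply,
    ContinuousAlternatingMap.curryLeft_apply_apply,
    ContinuousAlternatingMap.alternatizeUncurryFin_apply, Fin.sum_univ_succ (n := q + 1)]
  simp only [Fin.val_zero, pow_zero, one_smul, Matrix.cons_val_zero, Fin.val_succ, pow_succ,
    Matrix.cons_val_succ, mul_neg, mul_one, neg_smul, Finset.sum_neg_distrib]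
  -- The zeroth term of the alternatization is `L w v`; in the other terms `w` stays in front, and
  -- they match the left side up to sign.
  have h0 : Fin.removeNth 0 (Matrix.vecCons w v) = v := by
    ext i; rfl
  rw [h0, ← sub_eq_add_neg, sub_sub_cancel]
  refine Finset.sum_congr rfl fun i _ => ?_
  have hi : Fin.removeNth i.succ (Matrix.vecCons w v) = Matrix.vecCons w (i.removeNth v) := by
    ext j
    refine Fin.cases ?_ (fun j => ?_) j
    · simp [Fin.removeNth]
    · simp [Fin.removeNth]
  rw [hi]
  rfl

/-- The radial homotopy formula behind Poincaré's lemma, with the interior product `κ` and the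
alternatization `σ` kept abstract. -/
theorem exists_alternatization_fderiv_eq [ProperSpace E] {A G : Type w} [NormedAddCommGroup A]
    [NormedSpace ℝ A] [CompleteSpace A] [NormedAddCommGroup G] [NormedSpace ℝ G] [CompleteSpace G]
    (κ : A →L[ℝ] E →L[ℝ] G) (σ : (E →L[ℝ] G) →L[ℝ] A) {q : ℕ}
    (hσκ : ∀ u, σ (κ u) = ((q : ℝ) + 1) • u)
    {α : E → A} (hα : ContDiff ℝ ∞ α) {a : E} {r : ℝ}
    (hd : ∀ y ∈ Metric.ball a r, ∀ w,
      σ ((ContinuousLinearMap.apply ℝ G w).comp (κ.comp (fderiv ℝ α y))) = fderiv ℝ α y w) :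
    ∃ η : E → G, ContDiff ℝ ∞ η ∧ ∀ y ∈ Metric.ball a r, σ (fderiv ℝ η y) = α y := by
  -- The usual integrand: contract with the radial vector `y - a` along the segment from `a` to `y`,
  -- with weight `t ^ q` because `α` stands for a form of degree `q + 1`.
  let F : E → ℝ → G := fun y t => t ^ q • κ (α (a + t • (y - a))) (y - a)
  have hF : ContDiff ℝ ∞ (Function.uncurry F) := by
    have h1 : ContDiff ℝ ∞ fun p : E × ℝ => a + p.2 • (p.1 - a) := by fun_prop
    have h2 : ContDiff ℝ ∞ fun p : E × ℝ => κ (α (a + p.2 • (p.1 - a))) :=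
      κ.contDiff.comp (hα.comp h1)
    exact (contDiff_snd.pow q).smul (h2.clm_apply (contDiff_fst.sub contDiff_const))
  refine ⟨fun y => ∫ t in (0 : ℝ)..1, F y t, contDiff_intervalIntegral hF 0 1, fun y hy => ?_⟩
  have hαd : Differentiable ℝ α := hα.differentiable (by simp)
  set w := y - a with hw
  have hderiv : ∀ t : ℝ, HasFDerivAt (fun z => F z t)
      (t ^ q • (t • ((ContinuousLinearMap.apply ℝ G w).comp
        (κ.comp (fderiv ℝ α (a + t • w)))) + κ (α (a + t • w)))) y := by
    intro t
    have h1 : HasFDerivAt (fun z : E => a + t • (z - a)) (t • ContinuousLinearMap.id ℝ E) y :=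
      (((hasFDerivAt_id y).sub_const a).const_smul t).const_add a
    have h2 := (κ.hasFDerivAt.comp y ((hαd _).hasFDerivAt.comp y h1)).clm_apply
      ((hasFDerivAt_id y).sub_const a)
    refine (h2.const_smul (t ^ q)).congr_fderiv ?_
    ext v
    simp [hw, add_comm]
  have hint := hasFDerivAt_intervalIntegral_of_contDiff (hF.of_le (by simp)) 0 1 y
  have hcont : Continuous fun t => fderiv ℝ (fun z => F z t) y := by
    have : ContDiff ℝ ∞ (Function.uncurry fun (t : ℝ) (z : E) => F z t) :=
      hF.comp (contDiff_snd.prodMk contDiff_fst)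
    exact (this.fderiv (n := 0) contDiff_const (by simp)).continuous
  rw [hint.fderiv, ← ContinuousLinearMap.intervalIntegral_comp_comm _
    (hcont.intervalIntegrable _ _)]
  -- The alternatized integrand is the derivative of `P`: closedness (`hd`) gives the derivative of
  -- `α` along the segment, `hσκ` gives the factor `q + 1`. Then `P 1 = α y` and `P 0 = 0`.
  let P : ℝ → A := fun t => t ^ (q + 1) • α (a + t • w)
  have hP : ∀ t ∈ uIcc (0 : ℝ) 1, HasDerivAt P (σ (fderiv ℝ (fun z => F z t) y)) t := by
    intro t ht
    rw [uIcc_of_le zero_le_one] at ht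
    have hmem : a + t • w ∈ Metric.ball a r := by
      rw [Metric.mem_ball, dist_eq_norm] at hy ⊢
      rw [add_sub_cancel_left, norm_smul, Real.norm_of_nonneg ht.1]
      exact (mul_le_of_le_one_left (norm_nonneg _) ht.2).trans_lt hy
    have h1 : HasDerivAt (fun t : ℝ => a + t • w) w t := by
      simpa using ((hasDerivAt_id t).smul_const w).const_add a
    have h2 := (hasDerivAt_pow (q + 1) t).smul ((hαd (a + t • w)).hasFDerivAt.comp_hasDerivAt t h1)
    refine h2.congr_deriv ?_
    rw [(hderiv t).fderiv, map_smul, map_add, map_smul, hd _ hmem, hσκ]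
    simp only [Nat.add_sub_cancel, Nat.cast_add, Nat.cast_one, smul_add, smul_smul, pow_succ,
      mul_comm]
    rfl
  rw [intervalIntegral.integral_eq_sub_of_hasDerivAt hP]
  · simp [P, hw]
  · exact (σ.continuous.comp hcont).intervalIntegrable _ _

/-- Poincaré's lemma for a globally smooth form which is closed on a ball. -/
theorem exists_extDeriv_eq_of_contDiff [FiniteDimensional ℝ E] {q : ℕ}
    {α : E → E [⋀^Fin (q + 1)]→L[ℝ] ℝ} (hα : ContDiff ℝ ∞ α) {a : E} {r : ℝ}
    (hd : ∀ y ∈ Metric.ball a r, extDeriv α y = 0) :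
    ∃ η : E → E [⋀^Fin q]→L[ℝ] ℝ, ContDiff ℝ ∞ η ∧ ∀ y ∈ Metric.ball a r, extDeriv η y = α y := by
  have : ProperSpace E := FiniteDimensional.proper ℝ E
  refine exists_alternatization_fderiv_eq
    (ContinuousAlternatingMap.curryLeftLI (𝕜 := ℝ) (E := E) (F := ℝ)
      (n := q)).toContinuousLinearMap
    (ContinuousAlternatingMap.alternatizeUncurryFinCLM ℝ E ℝ) (q := q) (fun u => ?_) hα
    (fun y hy w => ?_)
  · refine (ContinuousAlternatingMap.alternatizeUncurryFin_curryLeft u).trans ?_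
    ext v
    simp
  · refine (alternatizeUncurryFin_curryLeft_comp (fderiv ℝ α y) w).trans ?_
    have h : ContinuousAlternatingMap.alternatizeUncurryFin (fderiv ℝ α y) = 0 := hd y hy
    rw [h, ContinuousAlternatingMap.curryLeft_zero]
    simp

/-- **Poincaré's lemma**, with a loss of domain. -/
theorem exists_extDeriv_eq_on_ball [FiniteDimensional ℝ E] {q : ℕ}
    {α : E → E [⋀^Fin (q + 1)]→L[ℝ] ℝ} {a : E} {r R : ℝ} (hr : 0 < r) (hR : r < R)
    (hα : ContDiffOn ℝ ∞ α (Metric.ball a R))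
    (hd : ∀ y ∈ Metric.ball a r, extDeriv α y = 0) :
    ∃ η : E → E [⋀^Fin q]→L[ℝ] ℝ, ContDiff ℝ ∞ η ∧ ∀ y ∈ Metric.ball a r, extDeriv η y = α y := by
  have hmid : r < (r + R) / 2 := by linarith
  -- The homotopy formula wants a globally smooth form. The cutoff is `1` on the ball of radius `r`
  -- and vanishes before radius `R`, so `b • α` extends by zero.
  let b : ContDiffBump a := ⟨r, (r + R) / 2, hr, hmid⟩
  have hsm : ContDiff ℝ ∞ fun y => b y • α y := by
    rw [contDiff_iff_contDiffAt]
    intro y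
    by_cases hy : y ∈ Metric.ball a R
    · exact b.contDiff.contDiffAt.smul (hα.contDiffAt (Metric.isOpen_ball.mem_nhds hy))
    · have : (fun y => b y • α y) =ᶠ[𝓝 y] fun _ => 0 := by
        have hy' : y ∈ (Metric.closedBall a ((r + R) / 2))ᶜ := fun h =>
          hy (Metric.closedBall_subset_ball (by linarith) h)
        filter_upwards [Metric.isClosed_closedBall.isOpen_compl.mem_nhds hy'] with z hz
        rw [b.zero_of_le_dist, zero_smul]
        exact (not_le.1 fun h => hz (Metric.mem_closedBall.2 h)).le
      exact contDiffAt_const.congr_of_eventuallyEq this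
  have hev : ∀ y ∈ Metric.ball a r, (fun y => b y • α y) =ᶠ[𝓝 y] α := by
    intro y hy
    filter_upwards [Metric.isOpen_ball.mem_nhds hy] with z hz
    rw [b.one_of_mem_closedBall (Metric.ball_subset_closedBall hz), one_smul]
  obtain ⟨η, hη, hη'⟩ := exists_extDeriv_eq_of_contDiff hsm (a := a) (r := r)
    fun y hy => by rw [(hev y hy).extDeriv_eq, hd y hy]
  exact ⟨η, hη, fun y hy => by rw [hη' y hy]; exact (hev y hy).self_of_nhds⟩

/-- A `0`-form with vanishing exterior derivative on a ball is constant there. -/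
theorem eq_of_extDeriv_eq_zero_on_ball {α : E → E [⋀^Fin 0]→L[ℝ] ℝ} {a : E} {r : ℝ}
    (hα : ContDiffOn ℝ ∞ α (Metric.ball a r))
    (hd : ∀ y ∈ Metric.ball a r, extDeriv α y = 0) {y z : E} (hy : y ∈ Metric.ball a r)
    (hz : z ∈ Metric.ball a r) : α y = α z := by
  refine Metric.isOpen_ball.is_const_of_fderiv_eq_zero (convex_ball a r).isPreconnected
    (hα.differentiableOn (by simp)) (fun x hx => ?_) hy hz
  have h := hd x hx
  ext u v
  have h2 := DFunLike.congr_fun h (fun _ => u)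
  rw [extDeriv, ContinuousAlternatingMap.alternatizeUncurryFin_apply] at h2
  simpa [Subsingleton.elim v (Fin.removeNth 0 fun _ => u)] using h2

end Poincare

end DiffForm

namespace DiffForm

/-! ### Smooth forms -/

section Smoothness

variable {E : Type*} [NormedAddCommGroup E] [NormedSpace ℝ E]

/-- Arguments are fed in one at a time through `curryLeft`. -/
theorem contDiffOn_alternating_apply {Z : Type*} [NormedAddCommGroup Z] [NormedSpace ℝ Z]
    {s : Set Z} {k : ℕ} {f : Z → E [⋀^Fin k]→L[ℝ] ℝ} (hf : ContDiffOn ℝ ∞ f s)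
    {u : Z → Fin k → E} (hu : ∀ i, ContDiffOn ℝ ∞ (fun z => u z i) s) :
    ContDiffOn ℝ ∞ (fun z => f z (u z)) s := by
  induction k with
  | zero =>
    have h := (ContinuousAlternatingMap.constOfIsEmptyLIE ℝ E ℝ (Fin 0)).symm.contDiff (n := ∞)
      |>.comp_contDiffOn hf
    refine h.congr fun z _ => ?_
    change _ = f z 0
    rw [Subsingleton.elim (u z) 0]
  | succ k ih =>
    let κ : (E [⋀^Fin (k + 1)]→L[ℝ] ℝ) →L[ℝ] E →L[ℝ] E [⋀^Fin k]→L[ℝ] ℝ :=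
      (ContinuousAlternatingMap.curryLeftLI (𝕜 := ℝ) (E := E) (F := ℝ)
        (n := k)).toContinuousLinearMap
    have hκ : ContDiff ℝ ∞ fun x => κ x := by fun_prop
    have h1 : ContDiffOn ℝ ∞ (fun z => (f z).curryLeft) s := hκ.comp_contDiffOn hf
    refine (ih (h1.clm_apply (hu 0)) (u := fun z i => u z i.succ) fun i => hu i.succ).congr
      fun z _ => ?_
    rw [ContinuousAlternatingMap.curryLeft_apply_apply]
    congr 1
    exact (Matrix.cons_head_tail (u z)).symm

/-- An alternating map of degree `k + 1` is `1 / (k + 1)` times the alternatization of its currying,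
so induction reduces to linear maps, for which finite dimension makes pointwise smoothness enough.
-/
theorem contDiffOn_alternating_of_apply [FiniteDimensional ℝ E] {Z : Type*}
    [NormedAddCommGroup Z] [NormedSpace ℝ Z]
    {s : Set Z} {k : ℕ} {f : Z → E [⋀^Fin k]→L[ℝ] ℝ}
    (hf : ∀ v, ContDiffOn ℝ ∞ (fun z => f z v) s) : ContDiffOn ℝ ∞ f s := by
  induction k with
  | zero =>
    have h := (ContinuousAlternatingMap.constOfIsEmptyLIE ℝ E ℝ (Fin 0)).contDiff (n := ∞)
      |>.comp_contDiffOn (hf 0)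
    refine h.congr fun z _ => ?_
    ext v
    change f z v = f z 0
    rw [Subsingleton.elim v 0]
  | succ k ih =>
    have h1 : ContDiffOn ℝ ∞ (fun z => (f z).curryLeft) s := by
      refine contDiffOn_clm_apply.2 fun x => ih fun v => ?_
      exact hf (Matrix.vecCons x v)
    have h2 : ContDiffOn ℝ ∞ (fun z => ((k + 1 : ℝ)⁻¹) •
        ContinuousAlternatingMap.alternatizeUncurryFinCLM ℝ E ℝ ((f z).curryLeft)) s :=
      ((ContinuousAlternatingMap.alternatizeUncurryFinCLM ℝ E ℝ).contDiff.comp_contDiffOn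
        h1).const_smul _
    refine h2.congr fun z _ => ?_
    rw [ContinuousAlternatingMap.alternatizeUncurryFinCLM_apply,
      ContinuousAlternatingMap.alternatizeUncurryFin_curryLeft]
    ext v
    have : (k + 1 : ℝ) ≠ 0 := by positivity
    simp [this]

theorem contDiffOn_compContinuousLinearMap [FiniteDimensional ℝ E] {Z : Type*}
    [NormedAddCommGroup Z] [NormedSpace ℝ Z]
    {s : Set Z} {k : ℕ} {f : Z → E [⋀^Fin k]→L[ℝ] ℝ} {g : Z → E →L[ℝ] E}
    (hf : ContDiffOn ℝ ∞ f s) (hg : ContDiffOn ℝ ∞ g s) :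
    ContDiffOn ℝ ∞ (fun z => (f z).compContinuousLinearMap (g z)) s :=
  contDiffOn_alternating_of_apply fun v =>
    contDiffOn_alternating_apply hf (u := fun z i => g z (v i))
      fun _ => hg.clm_apply contDiffOn_const

end Smoothness

variable {E : Type*} [NormedAddCommGroup E] [NormedSpace ℝ E]
  {M : Type*} [TopologicalSpace M] [ChartedSpace E M] {k : ℕ}

theorem IsSmoothOn.congr {U : Set M} {θ η : RawForm E M k} (hθ : IsSmoothOn U θ)
    (h : ∀ x ∈ U, η x = θ x) : IsSmoothOn U η := fun φ hφ =>
  (hθ φ hφ).congr fun y hy => by rw [inChart, inChart, h _ hy.2]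

theorem d_congr {U : Set M} (hU : IsOpen U) {θ η : RawForm E M k} (h : ∀ x ∈ U, θ x = η x)
    {x : M} (hx : x ∈ U) : d θ x = d η x := by
  have hev : inChart (chartAt E x) θ =ᶠ[𝓝 (chartAt E x x)] inChart (chartAt E x) η := by
    filter_upwards [((chartAt E x).isOpen_inter_preimage_symm hU).mem_nhds
      ⟨mem_chart_target E x, by simpa using hx⟩] with z hz
    rw [inChart, inChart, h _ hz.2]
  rw [d, d, hev.extDeriv_eq]

theorem IsSmoothOn.neg {U : Set M} {θ : RawForm E M k} (hθ : IsSmoothOn U θ) :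
    IsSmoothOn U (-θ) := by
  simpa using hθ.smul (-1)

theorem IsSmoothOn.sub {U : Set M} {θ η : RawForm E M k} (hθ : IsSmoothOn U θ)
    (hη : IsSmoothOn U η) : IsSmoothOn U (θ - η) := by
  rw [sub_eq_add_neg]
  exact hθ.add hη.neg

theorem d_neg (θ : RawForm E M k) : d (-θ) = -d θ := by
  have h : -θ = (-1 : ℝ) • θ := by simp
  rw [h, d_smul, neg_one_smul]

theorem d_sub {U : Set M} (hU : IsOpen U) {θ η : RawForm E M k} (hθ : IsSmoothOn U θ)
    (hη : IsSmoothOn U η) {x : M} (hx : x ∈ U) : d (θ - η) x = d θ x - d η x := by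
  rw [sub_eq_add_neg, d_add hU hθ hη.neg hx, d_neg]
  exact (sub_eq_add_neg _ _).symm

theorem IsSmoothOn.sum {ι : Type*} (s : Finset ι) {U : Set M} {θ : ι → RawForm E M k}
    (hθ : ∀ i ∈ s, IsSmoothOn U (θ i)) : IsSmoothOn U (∑ i ∈ s, θ i) := by
  classical
  induction s using Finset.induction_on with
  | empty => simpa using IsSmoothOn.zero U
  | insert a s ha ih =>
    rw [Finset.sum_insert ha]
    exact (hθ a (by simp)).add (ih fun i hi => hθ i (by simp [hi]))

theorem sum_apply {ι : Type*} (s : Finset ι) (θ : ι → RawForm E M k) (x : M) :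
    (∑ i ∈ s, θ i) x = ∑ i ∈ s, θ i x := Finset.sum_apply x s θ

theorem d_sum {ι : Type*} (s : Finset ι) {U : Set M} (hU : IsOpen U) {θ : ι → RawForm E M k}
    (hθ : ∀ i ∈ s, IsSmoothOn U (θ i)) {x : M} (hx : x ∈ U) :
    d (∑ i ∈ s, θ i) x = ∑ i ∈ s, d (θ i) x := by
  classical
  induction s using Finset.induction_on with
  | empty => simp [d_zero, zero_apply]
  | insert a s ha ih =>
    rw [Finset.sum_insert ha, Finset.sum_insert ha, d_add hU (hθ a (by simp))
      (IsSmoothOn.sum s fun i hi => hθ i (by simp [hi])) hx, ih fun i hi => hθ i (by simp [hi])]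

/-- Multiplication of a form by a function. -/
noncomputable def fsmul (ρ : M → ℝ) (θ : RawForm E M k) : RawForm E M k := fun x => ρ x • θ x

variable [IsManifold 𝓘(ℝ, E) ∞ M]

theorem IsSmoothOn.fsmul {U : Set M} {ρ : M → ℝ} {θ : RawForm E M k}
    (hρ : ∀ x ∈ U, ContMDiffAt 𝓘(ℝ, E) 𝓘(ℝ, ℝ) ∞ ρ x) (hθ : IsSmoothOn U θ) :
    IsSmoothOn U (fsmul ρ θ) := by
  intro φ hφ
  have h : ContDiffOn ℝ ∞ (fun y => ρ (φ.symm y)) (φ.target ∩ φ.symm ⁻¹' U) := fun y hy =>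
    ((hρ _ hy.2).comp y (contMDiffAt_symm_of_mem_maximalAtlas (n := ∞)
        (IsManifold.subset_maximalAtlas hφ) hy.1)).contDiffAt.contDiffWithinAt
  exact (h.smul (hθ φ hφ)).congr fun y _ => rfl

theorem contDiffOn_transition {φ ψ : OpenPartialHomeomorph M E}
    (hφ : φ ∈ atlas E M) (hψ : ψ ∈ atlas E M) :
    ContDiffOn ℝ ∞ (ψ ∘ φ.symm) (φ.target ∩ φ.symm ⁻¹' ψ.source) := fun y hy =>
  ((contMDiffAt_of_mem_maximalAtlas (I := 𝓘(ℝ, E)) (n := ∞)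
      (IsManifold.subset_maximalAtlas hψ) hy.2).comp y
      (contMDiffAt_symm_of_mem_maximalAtlas (n := ∞)
        (IsManifold.subset_maximalAtlas hφ) hy.1)).contDiffAt.contDiffWithinAt

/-- Smoothness may be checked locally, each time in a single chart. -/
theorem isSmoothOn_of_locally [FiniteDimensional ℝ E] {U : Set M} {θ : RawForm E M k}
    (h : ∀ x ∈ U, ∃ φ ∈ atlas E M, ∃ V, IsOpen V ∧ x ∈ V ∧ V ⊆ φ.source ∧
      ContDiffOn ℝ ∞ (inChart φ θ) (φ.target ∩ φ.symm ⁻¹' V)) : IsSmoothOn U θ := by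
  intro ψ hψ y hy
  obtain ⟨φ, hφ, V, hV, hxV, hVs, hc⟩ := h _ hy.2
  set W := ψ.target ∩ ψ.symm ⁻¹' V
  have hW : IsOpen W := ψ.isOpen_inter_preimage_symm hV
  have hT : ContDiffOn ℝ ∞ (φ ∘ ψ.symm) W :=
    (contDiffOn_transition hψ hφ).mono fun z hz => ⟨hz.1, hVs hz.2⟩
  have h1 : ContDiffOn ℝ ∞ (fun z => inChart φ θ ((φ ∘ ψ.symm) z)) W :=
    hc.comp hT fun z hz => ⟨φ.map_source (hVs hz.2), by
      simpa [φ.left_inv (hVs hz.2)] using hz.2⟩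
  have h2 := contDiffOn_compContinuousLinearMap h1 (hT.fderiv_of_isOpen hW (m := ∞) (by simp))
  exact ((h2.congr fun z hz => inChart_eq θ hψ hφ hz.1 (hVs hz.2)).contDiffAt
    (hW.mem_nhds ⟨hy.1, hxV⟩)).contDiffWithinAt

theorem isSmoothOn_of_cover [FiniteDimensional ℝ E] {U : Set M} {θ : RawForm E M k}
    (h : ∀ x ∈ U, ∃ V, IsOpen V ∧ x ∈ V ∧ IsSmoothOn V θ) : IsSmoothOn U θ := by
  refine isSmoothOn_of_locally fun x hx => ?_
  obtain ⟨V, hV, hxV, hθ⟩ := h x hx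
  refine ⟨chartAt E x, chart_mem_atlas E x, V ∩ (chartAt E x).source,
    hV.inter (chartAt E x).open_source, ⟨hxV, mem_chart_source E x⟩, Set.inter_subset_right, ?_⟩
  exact (hθ.mono Set.inter_subset_left) _ (chart_mem_atlas E x)

/-- The form on `M` (meaningful on `φ.source`) with a given expression in the chart `φ`. -/
noncomputable def ofChart (φ : OpenPartialHomeomorph M E) (α : E → E [⋀^Fin k]→L[ℝ] ℝ) : RawForm E M k :=
  fun x => (α (φ x)).compContinuousLinearMap
    (mfderiv 𝓘(ℝ, E) 𝓘(ℝ, E) φ x : TangentSpace 𝓘(ℝ, E) x →L[ℝ] E)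

theorem inChart_ofChart {φ : OpenPartialHomeomorph M E} (hφ : φ ∈ atlas E M)
    (α : E → E [⋀^Fin k]→L[ℝ] ℝ) {y : E} (hy : y ∈ φ.target) : inChart φ (ofChart φ α) y = α y := by
  have hid : ((mfderiv 𝓘(ℝ, E) 𝓘(ℝ, E) φ (φ.symm y) : E →L[ℝ] E).comp
        (mfderiv 𝓘(ℝ, E) 𝓘(ℝ, E) φ.symm y : E →L[ℝ] E)) = ContinuousLinearMap.id ℝ E := by
    have h2 := mfderiv_comp y (mdiff_chart hφ (φ.map_target hy)) (mdiff_chart_symm hφ hy)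
    have h3 : φ ∘ φ.symm =ᶠ[𝓝 y] id := by
      filter_upwards [φ.open_target.mem_nhds hy] with z hz using φ.right_inv hz
    rw [h3.mfderiv_eq, mfderiv_id] at h2
    exact h2.symm
  change (α (φ (φ.symm y))).compContinuousLinearMap
    ((mfderiv 𝓘(ℝ, E) 𝓘(ℝ, E) φ (φ.symm y) : E →L[ℝ] E).comp
        (mfderiv 𝓘(ℝ, E) 𝓘(ℝ, E) φ.symm y : E →L[ℝ] E)) = α y
  rw [hid, φ.right_inv hy]
  ext v
  rfl

/-- Forms agree at a point when their expressions in a chart do. -/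
theorem eq_of_inChart_eq {φ : OpenPartialHomeomorph M E} (hφ : φ ∈ atlas E M)
    {θ η : RawForm E M k} {x : M} (hx : x ∈ φ.source)
    (h : inChart φ θ (φ x) = inChart φ η (φ x)) : θ x = η x := by
  have hid : ((mfderiv 𝓘(ℝ, E) 𝓘(ℝ, E) φ.symm (φ x) : E →L[ℝ] E).comp
        (mfderiv 𝓘(ℝ, E) 𝓘(ℝ, E) φ x : E →L[ℝ] E)) = ContinuousLinearMap.id ℝ E := by
    have h2 := mfderiv_comp x (mdiff_chart_symm hφ (φ.map_source hx)) (mdiff_chart hφ hx)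
    have h3 : φ.symm ∘ φ =ᶠ[𝓝 x] id := by
      filter_upwards [φ.open_source.mem_nhds hx] with z hz using φ.left_inv hz
    rw [h3.mfderiv_eq, mfderiv_id] at h2
    exact h2.symm
  have key : ∀ ζ : RawForm E M k, (inChart φ ζ (φ x)).compContinuousLinearMap
      (mfderiv 𝓘(ℝ, E) 𝓘(ℝ, E) φ x : E →L[ℝ] E) = ζ x := by
    intro ζ
    let ζ' : M → E [⋀^Fin k]→L[ℝ] ℝ := ζ
    change (ζ' (φ.symm (φ x))).compContinuousLinearMap
      ((mfderiv 𝓘(ℝ, E) 𝓘(ℝ, E) φ.symm (φ x) : E →L[ℝ] E).comp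
        (mfderiv 𝓘(ℝ, E) 𝓘(ℝ, E) φ x : E →L[ℝ] E)) = ζ' x
    rw [hid, φ.left_inv hx]
    ext v
    rfl
  rw [← key θ, ← key η, h]

end DiffForm

namespace DiffForm

/-! ### Local primitives and partitions of unity -/

variable {E : Type*} [NormedAddCommGroup E] [NormedSpace ℝ E]
  {M : Type*} [TopologicalSpace M] [ChartedSpace E M] {k : ℕ}

/-- The constant `0`-form. -/
noncomputable def constForm (c : ℝ) : RawForm E M 0 := fun x =>
  ContinuousAlternatingMap.constOfIsEmpty ℝ (TangentSpace 𝓘(ℝ, E) x) (Fin 0) c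

/-- The function underlying a `0`-form. -/
noncomputable def toFun (θ : RawForm E M 0) (x : M) : ℝ := θ x fun i => i.elim0

theorem constForm_toFun (θ : RawForm E M 0) (x : M) :
    (constForm (toFun θ x) : RawForm E M 0) x = θ x := by
  refine ContinuousAlternatingMap.ext fun v => ?_
  rw [Subsingleton.elim v fun i => i.elim0]
  rfl

theorem inChart_constForm (φ : OpenPartialHomeomorph M E) (c : ℝ) :
    inChart φ (constForm c : RawForm E M 0) =
      fun _ => ContinuousAlternatingMap.constOfIsEmpty ℝ E (Fin 0) c := rfl

theorem isSmoothOn_constForm (U : Set M) (c : ℝ) :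
    IsSmoothOn U (constForm c : RawForm E M 0) := by
  intro φ _
  rw [inChart_constForm]
  exact contDiffOn_const

theorem d_constForm (c : ℝ) : d (constForm c : RawForm E M 0) = 0 := by
  funext x
  have h : extDeriv (fun _ : E => ContinuousAlternatingMap.constOfIsEmpty ℝ E (Fin 0) c)
      (chartAt E x x) = 0 := by
    rw [extDeriv, fderiv_fun_const]
    exact map_zero (ContinuousAlternatingMap.alternatizeUncurryFinCLM ℝ E ℝ)
  rw [d, inChart_constForm, h]
  rfl

variable [IsManifold 𝓘(ℝ, E) ∞ M]

/-- Every point has arbitrarily small open neighbourhoods on which Poincaré's lemma holds. -/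
theorem exists_open_poincare [FiniteDimensional ℝ E] {U : Set M} (hU : IsOpen U) {z : M}
    (hz : z ∈ U) : ∃ V : Set M, IsOpen V ∧ z ∈ V ∧ V ⊆ U ∧
      (∀ (q : ℕ) (θ : RawForm E M (q + 1)), IsSmoothOn U θ → (∀ x ∈ U, d θ x = 0) →
        ∃ η : RawForm E M q, IsSmoothOn V η ∧ ∀ x ∈ V, d η x = θ x) ∧
      ∀ θ : RawForm E M 0, IsSmoothOn U θ → (∀ x ∈ U, d θ x = 0) →
        ∀ x ∈ V, ∀ y ∈ V, toFun θ x = toFun θ y := by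
  set φ := chartAt E z with hφdef
  have hφ : φ ∈ atlas E M := chart_mem_atlas E z
  obtain ⟨R, hR, hball⟩ := Metric.isOpen_iff.1 (φ.isOpen_inter_preimage_symm hU) (φ z)
    ⟨mem_chart_target E z, by simpa [hφdef] using hz⟩
  have hlt : R / 2 < R := half_lt_self hR
  have hballs : Metric.ball (φ z) (R / 2) ⊆ Metric.ball (φ z) R := Metric.ball_subset_ball hlt.le
  set V : Set M := φ.source ∩ φ ⁻¹' Metric.ball (φ z) (R / 2) with hVdef
  have hV : IsOpen V := φ.isOpen_inter_preimage Metric.isOpen_ball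
  have hVU : V ⊆ U := fun x hx => by
    simpa [φ.left_inv hx.1] using (hball (hballs hx.2)).2
  have hd : ∀ (q : ℕ) (θ : RawForm E M q), IsSmoothOn U θ → (∀ x ∈ U, d θ x = 0) →
      ∀ y ∈ Metric.ball (φ z) R, extDeriv (inChart φ θ) y = 0 := by
    intro q θ hθ hdθ y hy
    rw [← inChart_d hU hθ hφ (hball hy).1 (hball hy).2, inChart, hdθ _ (hball hy).2]
    rfl
  -- `V` is fixed before any form is given: a cochain needs one neighbourhood that serves all tuples
  -- at once.
  refine ⟨V, hV, ⟨mem_chart_source E z, Metric.mem_ball_self (half_pos hR)⟩, hVU, ?_, ?_⟩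
  · intro q θ hθ hdθ
    obtain ⟨α, hα, hα'⟩ := exists_extDeriv_eq_on_ball (half_pos hR) hlt ((hθ φ hφ).mono hball)
      fun y hy => hd _ θ hθ hdθ y (hballs hy)
    have hsm : IsSmoothOn V (ofChart φ α : RawForm E M q) :=
      isSmoothOn_of_locally fun x hx => ⟨φ, hφ, V, hV, hx, Set.inter_subset_left,
        hα.contDiffOn.congr fun y hy => inChart_ofChart hφ α hy.1⟩
    refine ⟨ofChart φ α, hsm, fun x hx => eq_of_inChart_eq hφ hx.1 ?_⟩
    rw [inChart_d hV hsm hφ (φ.map_source hx.1) (by rwa [φ.left_inv hx.1]), ← hα' _ hx.2]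
    refine Filter.EventuallyEq.extDeriv_eq ?_
    filter_upwards [φ.open_target.mem_nhds (φ.map_source hx.1)] with y hy
    exact inChart_ofChart hφ α hy
  · intro θ hθ hdθ x hx y hy
    have h := eq_of_extDeriv_eq_zero_on_ball ((hθ φ hφ).mono hball) (hd _ θ hθ hdθ)
      (hballs hx.2) (hballs hy.2)
    have key : ∀ x ∈ V, inChart φ θ (φ x) (fun i => i.elim0) = toFun θ x := by
      intro x hx
      have : inChart φ θ (φ x) (fun i => i.elim0) = toFun θ (φ.symm (φ x)) :=
        congrArg (θ (φ.symm (φ x))) (Subsingleton.elim _ _)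
      rw [this, φ.left_inv hx.1]
    rw [← key x hx, ← key y hy, h]

/-- Smooth partitions of unity on an open subset, indexed by the points of the manifold and
subordinate to a choice of neighbourhoods of these points. -/
theorem exists_smooth_partition [FiniteDimensional ℝ E] [T2Space M] [SecondCountableTopology M]
    {U : Set M} (hU : IsOpen U) {V : M → Set M} (hV : ∀ a ∈ U, IsOpen (V a) ∧ a ∈ V a) :
    ∃ ρ : M → M → ℝ, (∀ a, ∀ x ∈ U, ContMDiffAt 𝓘(ℝ, E) 𝓘(ℝ, ℝ) ∞ (ρ a) x) ∧
      ∀ z ∈ U, ∃ W, IsOpen W ∧ z ∈ W ∧ W ⊆ U ∧ ∃ S : Finset M,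
        (∀ a ∈ S, a ∈ U ∧ W ⊆ V a) ∧ (∀ a ∉ S, ∀ x ∈ W, ρ a x = 0) ∧
        ∀ x ∈ W, ∑ a ∈ S, ρ a x = 1 := by
  classical
  let O : TopologicalSpace.Opens M := ⟨U, hU⟩
  have : ProperSpace E := FiniteDimensional.proper ℝ E
  have : LocallyCompactSpace O := ChartedSpace.locallyCompactSpace E O
  obtain ⟨f, hf⟩ := SmoothPartitionOfUnity.exists_isSubordinate 𝓘(ℝ, E) (M := O)
    isClosed_univ (fun a : O => (Subtype.val ⁻¹' V a : Set O))
    (fun a => (hV a a.2).1.preimage continuous_subtype_val)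
    fun a _ => Set.mem_iUnion.2 ⟨a, (hV a a.2).2⟩
  -- The partition lives on the open submanifold `U`. Its extension by zero need not be continuous
  -- at the boundary; only points of `U` matter.
  let ρ : M → M → ℝ := fun a x =>
    if h : a ∈ U ∧ x ∈ U then f (⟨a, h.1⟩ : O) (⟨x, h.2⟩ : O) else 0
  have hρ : ∀ a x : O, ρ a x = f a x := fun a x => dif_pos ⟨a.2, x.2⟩
  refine ⟨ρ, fun a x hx => ?_, fun z hz => ?_⟩
  · by_cases ha : a ∈ U
    · have h1 : ContMDiffAt 𝓘(ℝ, E) 𝓘(ℝ, ℝ) ∞ (fun y : O => ρ a y) (⟨x, hx⟩ : O) := by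
        have : (fun y : O => ρ a y) = f (⟨a, ha⟩ : O) := funext fun y => hρ ⟨a, ha⟩ y
        rw [this]
        exact (f (⟨a, ha⟩ : O)).contMDiff _
      exact contMDiffAt_subtype_iff.1 h1
    · have : ρ a = fun _ => 0 := funext fun y => dif_neg fun h => ha h.1
      rw [this]
      exact contMDiffAt_const
  · let z' : O := ⟨z, hz⟩
    -- Near `z` only the finitely many indices whose closed support contains `z` contribute, and `z`
    -- lies in each corresponding `V a`; hence a single `W` inside all of them.
    have hev : ∀ᶠ y in 𝓝 z', f.finsupport y ⊆ f.fintsupport z' ∧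
        ∀ a ∈ f.fintsupport z', (y : M) ∈ V a := by
      refine (f.eventually_finsupport_subset z').and ?_
      rw [Filter.eventually_all_finset]
      intro a ha
      exact ((hV a a.2).1.preimage continuous_subtype_val).mem_nhds
        (hf a ((f.mem_fintsupport_iff z' a).1 ha))
    obtain ⟨W, hW, hWo, hzW⟩ := eventually_nhds_iff.1 hev
    refine ⟨Subtype.val '' W, hU.isOpenMap_subtype_val W hWo, ⟨z', hzW, rfl⟩, ?_,
      (f.fintsupport z').image Subtype.val, ?_, ?_, ?_⟩
    · rintro _ ⟨y, _, rfl⟩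
      exact y.2
    · intro a ha
      obtain ⟨a, ha', rfl⟩ := Finset.mem_image.1 ha
      refine ⟨a.2, ?_⟩
      rintro _ ⟨y, hy, rfl⟩
      exact (hW y hy).2 a ha'
    · rintro a ha _ ⟨y, hy, rfl⟩
      by_cases haU : a ∈ U
      · rw [hρ ⟨a, haU⟩ y]
        by_contra hne
        exact ha (Finset.mem_image.2 ⟨⟨a, haU⟩, (hW y hy).1 ((f.mem_finsupport y).2 hne), rfl⟩)
      · exact dif_neg fun h => haU h.1
    · rintro _ ⟨y, hy, rfl⟩
      rw [Finset.sum_image fun _ _ _ _ h => Subtype.ext h]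
      simp only [hρ]
      exact f.sum_finsupport' y (Set.mem_univ y) (hW y hy).1

end DiffForm

namespace DiffForm

/-! ### Alexander–Spanier cochains -/

section AlexanderSpanier

variable {X A : Type*} [AddCommGroup A] [Module ℝ A] {p : ℕ}

/-- The Alexander–Spanier coboundary of a function of `p` points. -/
def coboundary : ((Fin p → X) → A) →ₗ[ℝ] ((Fin (p + 1) → X) → A) where
  toFun f x := ∑ i : Fin (p + 1), (-1 : ℝ) ^ (i : ℕ) • f (i.removeNth x)
  map_add' f g := by
    funext x
    simp [smul_add, Finset.sum_add_distrib]
  map_smul' r f := by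
    funext x
    simp only [Pi.smul_apply, RingHom.id_apply, Finset.smul_sum]
    exact Finset.sum_congr rfl fun i _ => smul_comm _ _ _

theorem coboundary_apply (f : (Fin p → X) → A) (x : Fin (p + 1) → X) :
    coboundary f x = ∑ i : Fin (p + 1), (-1 : ℝ) ^ (i : ℕ) • f (i.removeNth x) := rfl

theorem coboundary_zero_apply (f : (Fin 0 → X) → A) (x : Fin 1 → X) :
    coboundary f x = f Fin.elim0 := by
  rw [coboundary_apply, Fin.sum_univ_one, Fin.val_zero, pow_zero, one_smul]
  exact congrArg f (Subsingleton.elim _ _)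

/-- Prepending a point is a contracting homotopy: if `f` is a cocycle, it is the coboundary of `f
(Fin.cons a ·)`. This drives the exactness in `exists_coboundary_eq`. -/
theorem coboundary_cons (f : (Fin (p + 1) → X) → A) (a : X) (x : Fin (p + 1) → X) :
    coboundary f (Fin.cons a x) = f x - coboundary (fun y : Fin p → X => f (Fin.cons a y)) x := by
  rw [coboundary_apply, coboundary_apply, Fin.sum_univ_succ, Fin.val_zero, pow_zero, one_smul,
    sub_eq_add_neg, ← Finset.sum_neg_distrib]
  congr 1
  refine Finset.sum_congr rfl fun i _ => ?_
  rw [Fin.val_succ, pow_succ, mul_neg_one, neg_smul]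
  congr 3
  funext j
  refine Fin.cases ?_ (fun j => ?_) j <;> simp [Fin.removeNth]

theorem coboundary_coboundary (f : (Fin p → X) → A) : coboundary (coboundary f) = 0 := by
  induction p with
  | zero =>
    funext x
    rw [coboundary_apply, Fin.sum_univ_two]
    simp [coboundary_zero_apply]
  | succ p ih =>
    funext x
    rw [← Fin.cons_self_tail x, coboundary_cons]
    have h : (fun y : Fin (p + 1) → X => coboundary f (Fin.cons (x 0) y)) =
        f - coboundary (fun y : Fin p → X => f (Fin.cons (x 0) y)) :=
      funext fun y => coboundary_cons f (x 0) y
    rw [h, map_sub, ih, sub_zero, sub_self]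
    rfl

end AlexanderSpanier

/-! ### Germs of cochains along the diagonal -/

section NearDiagonal

variable {X : Type*} [TopologicalSpace X] {p : ℕ}

/-- The property `P` holds on small neighbourhoods, at tuples of points of these. -/
def NearDiag (U : Set X) (P : (Fin p → X) → Set X → Prop) : Prop :=
  ∀ z ∈ U, ∃ V, IsOpen V ∧ z ∈ V ∧ V ⊆ U ∧ ∀ x : Fin p → X, (∀ i, x i ∈ V) → P x V

theorem NearDiag.imp {U : Set X} {P Q : (Fin p → X) → Set X → Prop} (h : NearDiag U P)
    (hPQ : ∀ x V, IsOpen V → V ⊆ U → (∀ i, x i ∈ V) → P x V → Q x V) : NearDiag U Q := by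
  intro z hz
  obtain ⟨V, hV, hzV, hVU, hx⟩ := h z hz
  exact ⟨V, hV, hzV, hVU, fun x hxV => hPQ x V hV hVU hxV (hx x hxV)⟩

/-- The two neighbourhoods are intersected, which is why `P` and `Q` must pass to smaller sets. -/
theorem NearDiag.imp₂ {p' : ℕ} {U : Set X} {P Q : (Fin p → X) → Set X → Prop}
    {R : (Fin p' → X) → Set X → Prop}
    (hP : ∀ x V W, W ⊆ V → P x V → P x W) (hQ : ∀ x V W, W ⊆ V → Q x V → Q x W)
    (h : NearDiag U P) (h' : NearDiag U Q)
    (hPQ : ∀ x V, IsOpen V → V ⊆ U → (∀ i, x i ∈ V) →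
      (∀ y, (∀ i, y i ∈ V) → P y V) → (∀ y, (∀ i, y i ∈ V) → Q y V) → R x V) :
    NearDiag U R := by
  intro z hz
  obtain ⟨V, hV, hzV, hVU, hx⟩ := h z hz
  obtain ⟨W, hW, hzW, hWU, hy⟩ := h' z hz
  exact ⟨V ∩ W, hV.inter hW, ⟨hzV, hzW⟩, Set.inter_subset_left.trans hVU, fun x hxV =>
    hPQ x _ (hV.inter hW) (Set.inter_subset_left.trans hVU) hxV
      (fun y hyV => hP y V _ Set.inter_subset_left (hx y fun i => (hyV i).1))
      (fun y hyV => hQ y W _ Set.inter_subset_right (hy y fun i => (hyV i).2))⟩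

theorem NearDiag.mono {U U' : Set X} (hU' : IsOpen U') (hUU' : U' ⊆ U)
    {P : (Fin p → X) → Set X → Prop} (hP : ∀ x V W, W ⊆ V → P x V → P x W)
    (h : NearDiag U P) : NearDiag U' P := by
  intro z hz
  obtain ⟨V, hV, hzV, -, hx⟩ := h z (hUU' hz)
  exact ⟨V ∩ U', hV.inter hU', ⟨hzV, hz⟩, Set.inter_subset_right, fun x hxV =>
    hP x V _ Set.inter_subset_left (hx x fun i => (hxV i).1)⟩

/-- Equality of functions of `p` points near the diagonal. -/
def EqNear {A : Type*} (U : Set X) (f g : (Fin p → X) → A) : Prop :=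
  NearDiag U fun x _ => f x = g x

variable {A : Type*} {U : Set X} {f g h : (Fin p → X) → A}

theorem EqNear.of_eq (hU : IsOpen U) (hfg : f = g) : EqNear U f g := fun _ hz =>
  ⟨U, hU, hz, subset_rfl, fun x _ => congrFun hfg x⟩

theorem EqNear.symm (hfg : EqNear U f g) : EqNear U g f :=
  NearDiag.imp hfg fun _ _ _ _ _ h => Eq.symm h

theorem EqNear.trans (hfg : EqNear U f g) (hgh : EqNear U g h) : EqNear U f h :=
  NearDiag.imp₂ (fun _ _ _ _ h => h) (fun _ _ _ _ h => h) hfg hgh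
    fun x _ _ _ hx h1 h2 => (h1 x hx).trans (h2 x hx)

theorem EqNear.mono {U' : Set X} (hU' : IsOpen U') (hUU' : U' ⊆ U) (hfg : EqNear U f g) :
    EqNear U' f g := NearDiag.mono hU' hUU' (fun _ _ _ _ h => h) hfg

variable [AddCommGroup A]

theorem EqNear.add {f' g' : (Fin p → X) → A} (hfg : EqNear U f g) (hfg' : EqNear U f' g') :
    EqNear U (f + f') (g + g') :=
  NearDiag.imp₂ (fun _ _ _ _ h => h) (fun _ _ _ _ h => h) hfg hfg'
    fun x _ _ _ hx h1 h2 => congrArg₂ (· + ·) (h1 x hx) (h2 x hx)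

variable [Module ℝ A]

theorem EqNear.smul (r : ℝ) (hfg : EqNear U f g) : EqNear U (r • f) (r • g) :=
  NearDiag.imp hfg fun _ _ _ _ _ h => congrArg (r • ·) h

theorem EqNear.coboundary (hfg : EqNear U f g) : EqNear U (coboundary f) (coboundary g) := by
  intro z hz
  obtain ⟨V, hV, hzV, hVU, hx⟩ := hfg z hz
  refine ⟨V, hV, hzV, hVU, fun x hxV => ?_⟩
  change DiffForm.coboundary f x = DiffForm.coboundary g x
  rw [coboundary_apply, coboundary_apply]
  exact Finset.sum_congr rfl fun i _ => congrArg _ (hx _ fun j => hxV _)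

/-- A function of `p` points is an Alexander–Spanier coboundary on `U` (which means that it
vanishes near the diagonal if `p = 1`). -/
def IsCoboundaryOn (U : Set X) : {p : ℕ} → ((Fin (p + 1) → X) → ℝ) → Prop
  | 0, c => EqNear U c 0
  | p + 1, c => ∃ b : (Fin (p + 1) → X) → ℝ, EqNear U c (DiffForm.coboundary b)

theorem IsCoboundaryOn.zero (hU : IsOpen U) :
    ∀ {p : ℕ}, IsCoboundaryOn U (0 : (Fin (p + 1) → X) → ℝ)
  | 0 => .of_eq hU rfl
  | _ + 1 => ⟨0, .of_eq hU (map_zero _).symm⟩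

theorem IsCoboundaryOn.add : ∀ {p : ℕ} {b c : (Fin (p + 1) → X) → ℝ},
    IsCoboundaryOn U b → IsCoboundaryOn U c → IsCoboundaryOn U (b + c)
  | 0, _, _, hb, hc => (EqNear.add hb hc).trans
      (NearDiag.imp hb fun _ _ _ _ _ _ => add_zero _)
  | _ + 1, _, _, ⟨b', hb⟩, ⟨c', hc⟩ => ⟨b' + c', by
      rw [map_add]
      exact hb.add hc⟩

theorem IsCoboundaryOn.smul (r : ℝ) : ∀ {p : ℕ} {b : (Fin (p + 1) → X) → ℝ},
    IsCoboundaryOn U b → IsCoboundaryOn U (r • b)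
  | 0, _, hb => by
      have := EqNear.smul r hb
      rwa [smul_zero] at this
  | _ + 1, _, ⟨b', hb⟩ => ⟨r • b', by
      rw [map_smul]
      exact hb.smul r⟩

theorem IsCoboundaryOn.congr : ∀ {p : ℕ} {b c : (Fin (p + 1) → X) → ℝ},
    IsCoboundaryOn U b → EqNear U b c → IsCoboundaryOn U c
  | 0, _, _, hb, hbc => hbc.symm.trans hb
  | _ + 1, _, _, ⟨b', hb⟩, hbc => ⟨b', hbc.symm.trans hb⟩

theorem IsCoboundaryOn.mono {U' : Set X} (hU' : IsOpen U') (hUU' : U' ⊆ U) :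
    ∀ {p : ℕ} {b : (Fin (p + 1) → X) → ℝ}, IsCoboundaryOn U b → IsCoboundaryOn U' b
  | 0, _, hb => EqNear.mono hU' hUU' hb
  | _ + 1, _, ⟨b', hb⟩ => ⟨b', hb.mono hU' hUU'⟩

end NearDiagonal

end DiffForm

namespace DiffForm

/-! ### Form-valued cochains near the diagonal -/

variable (E : Type*) [NormedAddCommGroup E] [NormedSpace ℝ E]
  (M : Type*) [TopologicalSpace M] [ChartedSpace E M]

/-- Functions of `p` points with values in the (raw) `q`-forms. -/
abbrev Cochain (p q : ℕ) : Type _ := (Fin p → M) → RawForm E M q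

variable {E M} {p q : ℕ} {U : Set M} {α β γ : Cochain E M p q}

/-- Smoothness of a form-valued cochain near the diagonal. -/
def SmoothNear (U : Set M) (α : Cochain E M p q) : Prop :=
  NearDiag U fun x V => IsSmoothOn V (α x)

/-- Equality of form-valued cochains near the diagonal. -/
def FormEqNear (U : Set M) (α β : Cochain E M p q) : Prop :=
  NearDiag U fun x V => ∀ y ∈ V, α x y = β x y

/-- The exterior derivative of a form-valued cochain. -/
noncomputable def dC (α : Cochain E M p q) : Cochain E M p (q + 1) := fun x => d (α x)

/-- A function of `p` points as a cochain of constant `0`-forms. -/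
noncomputable def constC (c : (Fin p → M) → ℝ) : Cochain E M p 0 := fun x => constForm (c x)

theorem smooth_anti (α : Cochain E M p q) (x : Fin p → M) (V W : Set M) (h : W ⊆ V) :
    IsSmoothOn V (α x) → IsSmoothOn W (α x) := fun hα => hα.mono h

theorem formEq_anti (α β : Cochain E M p q) (x : Fin p → M) (V W : Set M) (h : W ⊆ V) :
    (∀ y ∈ V, α x y = β x y) → ∀ y ∈ W, α x y = β x y := fun hα y hy => hα y (h hy)

theorem FormEqNear.of_eq (hU : IsOpen U) (h : α = β) : FormEqNear U α β := fun _ hz =>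
  ⟨U, hU, hz, subset_rfl, fun _ _ _ _ => by rw [h]⟩

theorem FormEqNear.symm (h : FormEqNear U α β) : FormEqNear U β α :=
  NearDiag.imp h fun _ _ _ _ _ h y hy => (h y hy).symm

theorem FormEqNear.trans (h : FormEqNear U α β) (h' : FormEqNear U β γ) : FormEqNear U α γ :=
  NearDiag.imp₂ (formEq_anti _ _) (formEq_anti _ _) h h'
    fun x _ _ _ hx h1 h2 y hy => (h1 x hx y hy).trans (h2 x hx y hy)

theorem FormEqNear.add {α' β' : Cochain E M p q} (h : FormEqNear U α β)
    (h' : FormEqNear U α' β') : FormEqNear U (α + α') (β + β') :=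
  NearDiag.imp₂ (formEq_anti _ _) (formEq_anti _ _) h h'
    fun x _ _ _ hx h1 h2 y hy => congrArg₂ (· + ·) (h1 x hx y hy) (h2 x hx y hy)

theorem FormEqNear.sub {α' β' : Cochain E M p q} (h : FormEqNear U α β)
    (h' : FormEqNear U α' β') : FormEqNear U (α - α') (β - β') :=
  NearDiag.imp₂ (formEq_anti _ _) (formEq_anti _ _) h h'
    fun x _ _ _ hx h1 h2 y hy => congrArg₂ (· - ·) (h1 x hx y hy) (h2 x hx y hy)

theorem FormEqNear.smul (r : ℝ) (h : FormEqNear U α β) : FormEqNear U (r • α) (r • β) :=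
  NearDiag.imp h fun _ _ _ _ _ h y hy => congrArg (r • ·) (h y hy)

theorem FormEqNear.mono {U' : Set M} (hU' : IsOpen U') (hUU' : U' ⊆ U) (h : FormEqNear U α β) :
    FormEqNear U' α β := NearDiag.mono hU' hUU' (formEq_anti _ _) h

theorem FormEqNear.dC (h : FormEqNear U α β) : FormEqNear U (dC α) (dC β) :=
  NearDiag.imp h fun _ _ hV _ _ h _ hy => d_congr hV h hy

theorem coboundary_form_apply (α : Cochain E M p q) (x : Fin (p + 1) → M) (y : M) :
    coboundary α x y = ∑ i : Fin (p + 1), (-1 : ℝ) ^ (i : ℕ) • α (i.removeNth x) y :=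
  sum_apply Finset.univ (fun i : Fin (p + 1) => (-1 : ℝ) ^ (i : ℕ) • α (i.removeNth x)) y

theorem FormEqNear.coboundary (h : FormEqNear U α β) :
    FormEqNear U (coboundary α) (coboundary β) := by
  intro z hz
  obtain ⟨V, hV, hzV, hVU, hx⟩ := h z hz
  refine ⟨V, hV, hzV, hVU, fun x hxV y hy => ?_⟩
  rw [coboundary_form_apply, coboundary_form_apply]
  exact Finset.sum_congr rfl fun i _ => congrArg _ (hx _ (fun j => hxV _) y hy)

theorem SmoothNear.zero (hU : IsOpen U) : SmoothNear U (0 : Cochain E M p q) := fun _ hz =>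
  ⟨U, hU, hz, subset_rfl, fun _ _ => .zero U⟩

theorem SmoothNear.add (h : SmoothNear U α) (h' : SmoothNear U β) : SmoothNear U (α + β) :=
  NearDiag.imp₂ (smooth_anti _) (smooth_anti _) h h'
    fun x _ _ _ hx h1 h2 => (h1 x hx).add (h2 x hx)

theorem SmoothNear.sub (h : SmoothNear U α) (h' : SmoothNear U β) : SmoothNear U (α - β) :=
  NearDiag.imp₂ (smooth_anti _) (smooth_anti _) h h'
    fun x _ _ _ hx h1 h2 => (h1 x hx).sub (h2 x hx)

theorem SmoothNear.smul (r : ℝ) (h : SmoothNear U α) : SmoothNear U (r • α) :=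
  NearDiag.imp h fun _ _ _ _ _ h => h.smul r

theorem SmoothNear.mono {U' : Set M} (hU' : IsOpen U') (hUU' : U' ⊆ U) (h : SmoothNear U α) :
    SmoothNear U' α := NearDiag.mono hU' hUU' (smooth_anti _) h

theorem SmoothNear.congr (h : SmoothNear U α) (h' : FormEqNear U α β) : SmoothNear U β :=
  NearDiag.imp₂ (smooth_anti _) (formEq_anti _ _) h h'
    fun x _ _ _ hx h1 h2 => (h1 x hx).congr fun y hy => (h2 x hx y hy).symm

theorem SmoothNear.coboundary (h : SmoothNear U α) : SmoothNear U (coboundary α) := by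
  intro z hz
  obtain ⟨V, hV, hzV, hVU, hx⟩ := h z hz
  exact ⟨V, hV, hzV, hVU, fun x hxV => IsSmoothOn.sum _ fun i _ =>
    (hx _ fun j => hxV _).smul _⟩

theorem smoothNear_constC (hU : IsOpen U) (c : (Fin p → M) → ℝ) :
    SmoothNear U (constC c : Cochain E M p 0) := fun _ hz =>
  ⟨U, hU, hz, subset_rfl, fun _ _ => isSmoothOn_constForm _ _⟩

theorem dC_constC (c : (Fin p → M) → ℝ) : dC (constC c : Cochain E M p 0) = 0 :=
  funext fun _ => d_constForm _

theorem coboundary_constC (c : (Fin p → M) → ℝ) :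
    coboundary (constC c : Cochain E M p 0) = constC (coboundary c) := by
  funext x y
  rw [coboundary_form_apply, constC, coboundary_apply]
  refine ContinuousAlternatingMap.ext fun v => ?_
  rw [ContinuousAlternatingMap.sum_apply]
  rfl

theorem EqNear.constC {b c : (Fin p → M) → ℝ} (h : EqNear U b c) :
    FormEqNear U (constC b : Cochain E M p 0) (constC c) :=
  NearDiag.imp h fun _ _ _ _ _ h y _ => by rw [DiffForm.constC, DiffForm.constC, h]

/-- At least one point is required: the two constant forms are compared at `x 0`, which lies in the
neighbourhood. -/
theorem EqNear.of_constC {b c : (Fin (p + 1) → M) → ℝ}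
    (h : FormEqNear U (DiffForm.constC b : Cochain E M (p + 1) 0) (DiffForm.constC c)) :
    EqNear U b c :=
  NearDiag.imp h fun x _ _ _ hx h =>
    congrArg (fun ξ => ξ fun i => i.elim0) (h (x 0) (hx 0))

theorem dC_zero : dC (0 : Cochain E M p q) = 0 := funext fun _ => d_zero

theorem dC_smul (r : ℝ) (α : Cochain E M p q) : dC (r • α) = r • dC α := funext fun _ => d_smul _ _

theorem dC_add (h : SmoothNear U α) (h' : SmoothNear U β) :
    FormEqNear U (dC (α + β)) (dC α + dC β) :=
  NearDiag.imp₂ (smooth_anti _) (smooth_anti _) h h'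
    fun x _ hV _ hx h1 h2 _ hy => d_add hV (h1 x hx) (h2 x hx) hy

theorem dC_sub (h : SmoothNear U α) (h' : SmoothNear U β) :
    FormEqNear U (dC (α - β)) (dC α - dC β) :=
  NearDiag.imp₂ (smooth_anti _) (smooth_anti _) h h'
    fun x _ hV _ hx h1 h2 _ hy => d_sub hV (h1 x hx) (h2 x hx) hy

/-- The differentials commute without a sign. Smoothness is needed because `d` is additive only on
differentiable forms. -/
theorem dC_coboundary (h : SmoothNear U α) :
    FormEqNear U (dC (coboundary α)) (coboundary (dC α)) := by
  intro z hz
  obtain ⟨V, hV, hzV, hVU, hx⟩ := h z hz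
  refine ⟨V, hV, hzV, hVU, fun x hxV y hy => ?_⟩
  rw [coboundary_form_apply]
  refine (d_sum _ hV (fun i _ => (hx _ fun j => hxV _).smul _) hy).trans ?_
  exact Finset.sum_congr rfl fun i _ => by rw [d_smul]; rfl

variable [IsManifold 𝓘(ℝ, E) ∞ M]

theorem SmoothNear.dC (h : SmoothNear U α) : SmoothNear U (dC α) :=
  NearDiag.imp h fun _ _ hV _ _ h => h.d hV

theorem dC_dC (h : SmoothNear U α) : FormEqNear U (DiffForm.dC (DiffForm.dC α)) 0 :=
  NearDiag.imp h fun _ _ hV _ _ h _ hy => d_d hV h hy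

/-- A closed `0`-form is constant on a small ball, and the first point `x 0` lies in that ball, so
its value there is the constant. -/
theorem exists_constC_of_dC_eq_zero [FiniteDimensional ℝ E] {α : Cochain E M (p + 1) 0}
    (h : SmoothNear U α) (hd : FormEqNear U (DiffForm.dC α) 0) :
    ∃ c : (Fin (p + 1) → M) → ℝ, FormEqNear U α (constC c) := by
  refine ⟨fun x => toFun (α x) (x 0), fun z hz => ?_⟩
  obtain ⟨V, hV, hzV, hVU, hx⟩ := h z hz
  obtain ⟨V', hV', hzV', hVU', hx'⟩ := hd z hz
  obtain ⟨W, hW, hzW, hWV, -, hP⟩ := exists_open_poincare (E := E) (hV.inter hV') ⟨hzV, hzV'⟩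
  refine ⟨W, hW, hzW, fun y hy => hVU (hWV hy).1, fun x hxW y hy => ?_⟩
  have := hP (α x) ((hx x fun i => (hWV (hxW i)).1).mono Set.inter_subset_left)
    (fun y hy => hx' x (fun i => (hWV (hxW i)).2) y hy.2) y hy (x 0) (hxW 0)
  rw [constC, ← this, constForm_toFun]

variable [FiniteDimensional ℝ E] [T2Space M] [SecondCountableTopology M]

/-- Exactness in the direction of the forms. -/
theorem exists_dC_eq (hU : IsOpen U) {α : Cochain E M (p + 1) (q + 1)}
    (h : SmoothNear U α) (hd : FormEqNear U (DiffForm.dC α) 0) :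
    ∃ β : Cochain E M (p + 1) q, SmoothNear U β ∧ FormEqNear U (DiffForm.dC β) α := by
  classical
  have key : ∀ a ∈ U, ∃ V, IsOpen V ∧ a ∈ V ∧ ∀ x : Fin (p + 1) → M, (∀ i, x i ∈ V) →
      ∃ η : RawForm E M q, IsSmoothOn V η ∧ ∀ y ∈ V, d η y = α x y := by
    intro z hz
    obtain ⟨V, hV, hzV, hVU, hx⟩ := h z hz
    obtain ⟨V', hV', hzV', hVU', hx'⟩ := hd z hz
    obtain ⟨W, hW, hzW, hWV, hP, -⟩ := exists_open_poincare (E := E) (hV.inter hV') ⟨hzV, hzV'⟩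
    exact ⟨W, hW, hzW, fun x hxW => hP q (α x)
      ((hx x fun i => (hWV (hxW i)).1).mono Set.inter_subset_left)
      fun y hy => hx' x (fun i => (hWV (hxW i)).2) y hy.2⟩
  choose! V hVo hVa hV using key
  obtain ⟨ρ, -, hρ⟩ := exists_smooth_partition (E := E) hU fun a ha => ⟨hVo a ha, hVa a ha⟩
  -- A tuple must receive one primitive, independent of the neighbourhood from which it is viewed.
  -- The partition of unity serves only as a locally finite cover: each point `x` picks an index `a
  -- x` with `ρ (a x) x ≠ 0`, and the primitive of `α x` is taken on `V (a (x 0))`. Near `z` this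
  -- set contains all of `W`.
  have hne : ∀ x ∈ U, ∃ a, ρ a x ≠ 0 := by
    intro x hx
    obtain ⟨W, -, hxW, -, S, -, -, h1⟩ := hρ x hx
    by_contra! h0
    simpa [h0] using h1 x hxW
  choose! a ha using hne
  let β : Cochain E M (p + 1) q := fun x =>
    if h : ∃ η : RawForm E M q, IsSmoothOn (V (a (x 0))) η ∧ ∀ y ∈ V (a (x 0)), d η y = α x y
    then h.choose else 0
  have hβ : ∀ z ∈ U, ∃ W, IsOpen W ∧ z ∈ W ∧ W ⊆ U ∧ ∀ x : Fin (p + 1) → M, (∀ i, x i ∈ W) →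
      IsSmoothOn W (β x) ∧ ∀ y ∈ W, d (β x) y = α x y := by
    intro z hz
    obtain ⟨W, hW, hzW, hWU, S, hS, hS', -⟩ := hρ z hz
    refine ⟨W, hW, hzW, hWU, fun x hx => ?_⟩
    have haS : a (x 0) ∈ S := by
      by_contra hn
      exact ha _ (hWU (hx 0)) (hS' _ hn _ (hx 0))
    obtain ⟨haU, hWV⟩ := hS _ haS
    have hex := hV _ haU x fun i => hWV (hx i)
    have hβx : β x = hex.choose := dif_pos hex
    rw [hβx]
    exact ⟨hex.choose_spec.1.mono hWV, fun y hy => hex.choose_spec.2 y (hWV hy)⟩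
  refine ⟨β, fun z hz => ?_, fun z hz => ?_⟩ <;> obtain ⟨W, hW, hzW, hWU, hx⟩ := hβ z hz
  · exact ⟨W, hW, hzW, hWU, fun x hxW => (hx x hxW).1⟩
  · exact ⟨W, hW, hzW, hWU, fun x hxW => (hx x hxW).2⟩

/-- Exactness in the direction of the points. -/
theorem exists_coboundary_eq (hU : IsOpen U) {α : Cochain E M (p + 1) q}
    (h : SmoothNear U α) (hδ : FormEqNear U (coboundary α) 0) :
    ∃ β : Cochain E M p q, SmoothNear U β ∧ FormEqNear U (coboundary β) α := by
  have key : ∀ a ∈ U, ∃ V, IsOpen V ∧ a ∈ V ∧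
      (∀ x : Fin (p + 1) → M, (∀ i, x i ∈ V) → IsSmoothOn V (α x)) ∧
      ∀ x : Fin (p + 2) → M, (∀ i, x i ∈ V) → ∀ y ∈ V, coboundary α x y = 0 := by
    intro z hz
    obtain ⟨V, hV, hzV, hVU, hx⟩ := h z hz
    obtain ⟨V', hV', hzV', hVU', hx'⟩ := hδ z hz
    exact ⟨V ∩ V', hV.inter hV', ⟨hzV, hzV'⟩,
      fun x hxV => (hx x fun i => (hxV i).1).mono Set.inter_subset_left,
      fun x hxV y hy => hx' x (fun i => (hxV i).2) y hy.2⟩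
  choose! V hVo hVa hVs hVδ using key
  obtain ⟨ρ, hρs, hρ⟩ := exists_smooth_partition (E := E) hU fun a ha => ⟨hVo a ha, hVa a ha⟩
  -- The contraction of `coboundary_cons`, averaged over the prepended point `a`; the weights depend
  -- on the point `y` where the form is evaluated, so the result is smooth in `y`.
  let β : Cochain E M p q := fun x y => ∑ᶠ a, ρ a y • α (Fin.cons a x) y
  have hβ : ∀ {W : Set M} {S : Finset M}, (∀ a ∉ S, ∀ x ∈ W, ρ a x = 0) → ∀ x, ∀ y ∈ W,
      β x y = ∑ a ∈ S, ρ a y • α (Fin.cons a x) y := by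
    intro W S hS x y hy
    refine finsum_eq_sum_of_support_subset _ fun a ha => ?_
    by_contra hn
    exact ha (by simp [hS a hn y hy])
  refine ⟨β, fun z hz => ?_, fun z hz => ?_⟩ <;>
    obtain ⟨W, hW, hzW, hWU, S, hS, hS', h1⟩ := hρ z hz
  · refine ⟨W, hW, hzW, hWU, fun x hx => ?_⟩
    have hsum : IsSmoothOn W (∑ a ∈ S, fsmul (ρ a) (α (Fin.cons a x))) := by
      refine IsSmoothOn.sum _ fun a ha => IsSmoothOn.fsmul (fun y hy => hρs a y (hWU hy)) ?_
      refine (hVs a (hS a ha).1 (Fin.cons a x) fun i => ?_).mono (hS a ha).2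
      refine Fin.cases ?_ (fun i => ?_) i
      · exact hVa a (hS a ha).1
      · exact (hS a ha).2 (hx i)
    refine hsum.congr fun y hy => ?_
    rw [hβ hS' x y hy, sum_apply]
    rfl
  · refine ⟨W, hW, hzW, hWU, fun x hx y hy => ?_⟩
    -- Both `a` and the points of `x` lie in `V a`, so the cocycle condition is available at
    -- `Fin.cons a x`.
    have hcons : ∀ a ∈ S, coboundary (fun x' : Fin p → M => α (Fin.cons a x')) x y = α x y := by
      intro a ha
      have h2 := hVδ a (hS a ha).1 (Fin.cons a x) (fun i => by
        refine Fin.cases ?_ (fun i => ?_) i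
        · exact hVa a (hS a ha).1
        · exact (hS a ha).2 (hx i)) y ((hS a ha).2 hy)
      rw [coboundary_cons] at h2
      exact (sub_eq_zero.1 h2).symm
    calc coboundary β x y
        = ∑ i : Fin (p + 1), (-1 : ℝ) ^ (i : ℕ) •
            ∑ a ∈ S, ρ a y • α (Fin.cons a (i.removeNth x)) y := by
          rw [coboundary_form_apply]
          exact Finset.sum_congr rfl fun i _ => congrArg _ (hβ hS' _ y hy)
      _ = ∑ a ∈ S, ρ a y • coboundary (fun x' : Fin p → M => α (Fin.cons a x')) x y := by
          simp only [coboundary_form_apply, Finset.smul_sum]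
          rw [Finset.sum_comm]
          exact Finset.sum_congr rfl fun a _ => Finset.sum_congr rfl fun i _ => smul_comm _ _ _
      _ = α x y := by
          rw [Finset.sum_congr rfl fun a ha => congrArg _ (hcons a ha), ← Finset.sum_smul, h1 y hy,
            one_smul]

end DiffForm

namespace DiffForm

/-! ### Comparison of the cohomologies -/

/-- A linear relation which is total on both sides and matches `B` with `B'` induces an
isomorphism of the quotients. -/
theorem nonempty_quotient_equiv_of_relation {V V' : Type*} [AddCommGroup V] [Module ℝ V]
    [AddCommGroup V'] [Module ℝ V'] (A B : Submodule ℝ V) (A' B' : Submodule ℝ V')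
    (R : Submodule ℝ (V × V')) (hl : ∀ a ∈ A, ∃ a' ∈ A', (a, a') ∈ R)
    (hr : ∀ a' ∈ A', ∃ a ∈ A, (a, a') ∈ R)
    (hB : ∀ a ∈ A, ∀ a' ∈ A', (a, a') ∈ R → (a ∈ B ↔ a' ∈ B')) :
    Nonempty ((A ⧸ B.submoduleOf A) ≃ₗ[ℝ] (A' ⧸ B'.submoduleOf A')) := by
  -- The part of `R` over `A × A'` maps onto both quotients with the same kernel.
  let G : Submodule ℝ (V × V') := R ⊓ A.prod A'
  let f : G →ₗ[ℝ] A := ((LinearMap.fst ℝ V V').comp G.subtype).codRestrict A fun g => g.2.2.1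
  let f' : G →ₗ[ℝ] A' := ((LinearMap.snd ℝ V V').comp G.subtype).codRestrict A' fun g => g.2.2.2
  let π := (B.submoduleOf A).mkQ.comp f
  let π' := (B'.submoduleOf A').mkQ.comp f'
  have hπ : Function.Surjective π := (Submodule.mkQ_surjective _).comp fun a => by
    obtain ⟨a', ha', h⟩ := hl a a.2
    exact ⟨⟨(a, a'), h, a.2, ha'⟩, rfl⟩
  have hπ' : Function.Surjective π' := (Submodule.mkQ_surjective _).comp fun a' => by
    obtain ⟨a, ha, h⟩ := hr a' a'.2
    exact ⟨⟨(a, a'), h, ha, a'.2⟩, rfl⟩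
  have hker : LinearMap.ker π = LinearMap.ker π' := by
    ext g
    simp only [π, π', LinearMap.mem_ker, LinearMap.comp_apply, Submodule.mkQ_apply,
      Submodule.Quotient.mk_eq_zero]
    exact hB _ g.2.2.1 _ g.2.2.2 g.2.1
  exact ⟨(π.quotKerEquivOfSurjective hπ).symm ≪≫ₗ Submodule.quotEquivOfEq _ _ hker ≪≫ₗ
    π'.quotKerEquivOfSurjective hπ'⟩

section AlexanderSpanier

variable (X : Type*) [TopologicalSpace X] [T2Space X] (k : ℕ)

/-- Alexander–Spanier cocycles on `X` that are coboundaries outside a compact set. -/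
def spanierCocyclesAtInfinity : Submodule ℝ ((Fin (k + 1) → X) → ℝ) where
  carrier := {c | EqNear Set.univ (coboundary c) 0 ∧
    ∃ K : Set X, IsCompact K ∧ IsCoboundaryOn Kᶜ c}
  zero_mem' := ⟨.of_eq isOpen_univ (map_zero _), ∅, isCompact_empty,
    .zero isCompact_empty.isClosed.isOpen_compl⟩
  add_mem' := by
    rintro a b ⟨ha, K, hK, ha'⟩ ⟨hb, L, hL, hb'⟩
    have ho := (hK.union hL).isClosed.isOpen_compl
    refine ⟨?_, K ∪ L, hK.union hL, .add
      (ha'.mono ho (Set.compl_subset_compl.2 Set.subset_union_left))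
      (hb'.mono ho (Set.compl_subset_compl.2 Set.subset_union_right))⟩
    have := EqNear.add ha hb
    rwa [← map_add, add_zero] at this
  smul_mem' := by
    rintro r a ⟨ha, K, hK, ha'⟩
    refine ⟨?_, K, hK, ha'.smul r⟩
    have := EqNear.smul r ha
    rwa [← map_smul, smul_zero] at this

/-- Alexander–Spanier coboundaries. -/
def spanierCoboundaries : Submodule ℝ ((Fin (k + 1) → X) → ℝ) where
  carrier := {c | IsCoboundaryOn Set.univ c}
  zero_mem' := .zero isOpen_univ
  add_mem' := .add
  smul_mem' r _ := .smul r

/-- The Alexander–Spanier counterpart of `CohomologyExactAtInfinity`. -/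
abbrev SpanierCohomologyAtInfinity : Type _ :=
  spanierCocyclesAtInfinity X k ⧸
    (spanierCoboundaries X k).submoduleOf (spanierCocyclesAtInfinity X k)

end AlexanderSpanier

variable {E : Type*} [NormedAddCommGroup E] [NormedSpace ℝ E]
  {M : Type*} [TopologicalSpace M] [ChartedSpace E M]
variable {p q : ℕ} {U : Set M}

/-- The trivial classes in the double complex of form-valued cochains. -/
def IsNullOn (U : Set M) : {q : ℕ} → Cochain E M (p + 1) q → Prop
  | 0, α => ∃ c, IsCoboundaryOn U c ∧ FormEqNear U α (constC c)
  | q + 1, α => ∃ β : Cochain E M p q, SmoothNear U β ∧ FormEqNear U α (dC (coboundary β))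

theorem IsNullOn.zero (hU : IsOpen U) : ∀ {q : ℕ}, IsNullOn U (0 : Cochain E M (p + 1) q)
  | 0 => ⟨0, .zero hU, .of_eq hU rfl⟩
  | _ + 1 => ⟨0, .zero hU, .of_eq hU (by rw [map_zero, dC_zero])⟩

theorem IsNullOn.add : ∀ {q : ℕ} {α β : Cochain E M (p + 1) q},
    IsNullOn U α → IsNullOn U β → IsNullOn U (α + β)
  | 0, _, _, ⟨b, hb, hb'⟩, ⟨c, hc, hc'⟩ => ⟨b + c, hb.add hc, hb'.add hc'⟩
  | _ + 1, _, _, ⟨b, hb, hb'⟩, ⟨c, hc, hc'⟩ => ⟨b + c, hb.add hc, by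
      rw [map_add]
      exact (hb'.add hc').trans (dC_add hb.coboundary hc.coboundary).symm⟩

theorem IsNullOn.smul (r : ℝ) : ∀ {q : ℕ} {α : Cochain E M (p + 1) q},
    IsNullOn U α → IsNullOn U (r • α)
  | 0, _, ⟨b, hb, hb'⟩ => ⟨r • b, hb.smul r, hb'.smul r⟩
  | _ + 1, _, ⟨b, hb, hb'⟩ => ⟨r • b, hb.smul r, by
      rw [map_smul, dC_smul]
      exact hb'.smul r⟩

theorem IsNullOn.mono {U' : Set M} (hU' : IsOpen U') (h : U' ⊆ U) :
    ∀ {q : ℕ} {α : Cochain E M (p + 1) q}, IsNullOn U α → IsNullOn U' α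
  | 0, _, ⟨b, hb, hb'⟩ => ⟨b, hb.mono hU' h, hb'.mono hU' h⟩
  | _ + 1, _, ⟨b, hb, hb'⟩ => ⟨b, hb.mono hU' h, hb'.mono hU' h⟩

/-- Cocycles for both differentials. -/
structure IsCocycleOn (U : Set M) (α : Cochain E M p q) : Prop where
  smooth : SmoothNear U α
  dC_eq : FormEqNear U (dC α) 0
  coboundary_eq : FormEqNear U (coboundary α) 0

theorem IsCocycleOn.zero (hU : IsOpen U) : IsCocycleOn U (0 : Cochain E M p q) :=
  ⟨.zero hU, .of_eq hU dC_zero, .of_eq hU (map_zero _)⟩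

theorem IsCocycleOn.add {α β : Cochain E M p q} (hα : IsCocycleOn U α) (hβ : IsCocycleOn U β) :
    IsCocycleOn U (α + β) := by
  refine ⟨hα.1.add hβ.1, ?_, ?_⟩
  · have := hα.2.add hβ.2
    rw [add_zero] at this
    exact (dC_add hα.1 hβ.1).trans this
  · have := hα.3.add hβ.3
    rwa [← map_add, add_zero] at this

theorem IsCocycleOn.smul (r : ℝ) {α : Cochain E M p q} (hα : IsCocycleOn U α) :
    IsCocycleOn U (r • α) := by
  refine ⟨hα.1.smul r, ?_, ?_⟩
  · have := hα.2.smul r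
    rwa [← dC_smul, smul_zero] at this
  · have := hα.3.smul r
    rwa [← map_smul, smul_zero] at this

variable (E M p q)

/-- Cocycles of the double complex that are trivial outside a compact set. -/
def cocyclesAtInfinity [T2Space M] : Submodule ℝ (Cochain E M (p + 1) q) where
  carrier := {α | IsCocycleOn Set.univ α ∧ ∃ K : Set M, IsCompact K ∧ IsNullOn Kᶜ α}
  zero_mem' := ⟨.zero isOpen_univ, ∅, isCompact_empty,
    .zero isCompact_empty.isClosed.isOpen_compl⟩
  add_mem' := by
    rintro a b ⟨ha, K, hK, ha'⟩ ⟨hb, L, hL, hb'⟩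
    have ho := (hK.union hL).isClosed.isOpen_compl
    exact ⟨ha.add hb, K ∪ L, hK.union hL, .add
      (ha'.mono ho (Set.compl_subset_compl.2 Set.subset_union_left))
      (hb'.mono ho (Set.compl_subset_compl.2 Set.subset_union_right))⟩
  smul_mem' := by
    rintro r a ⟨ha, K, hK, ha'⟩
    exact ⟨ha.smul r, K, hK, ha'.smul r⟩

/-- The trivial classes of the double complex. -/
def nullCochains : Submodule ℝ (Cochain E M (p + 1) q) where
  carrier := {α | IsNullOn Set.univ α}
  zero_mem' := .zero isOpen_univ
  add_mem' := .add
  smul_mem' r _ := .smul r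

/-- The cohomology of the double complex in a given bidegree. -/
abbrev MixedCohomologyAtInfinity [T2Space M] : Type _ :=
  cocyclesAtInfinity E M p q ⧸ (nullCochains E M p q).submoduleOf (cocyclesAtInfinity E M p q)

/-- The relation given by one step of the zigzag. -/
def zigzag : Submodule ℝ (Cochain E M (p + 1) (q + 1) × Cochain E M (p + 2) q) where
  carrier := {z | ∃ β : Cochain E M (p + 1) q, SmoothNear Set.univ β ∧
    FormEqNear Set.univ (dC β) z.1 ∧ FormEqNear Set.univ (coboundary β) z.2}
  zero_mem' := ⟨0, .zero isOpen_univ, .of_eq isOpen_univ dC_zero, .of_eq isOpen_univ (map_zero _)⟩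
  add_mem' := by
    rintro _ _ ⟨β, hβ, h1, h2⟩ ⟨γ, hγ, h1', h2'⟩
    refine ⟨β + γ, hβ.add hγ, (dC_add hβ hγ).trans (h1.add h1'), ?_⟩
    rw [map_add]
    exact h2.add h2'
  smul_mem' := by
    rintro r _ ⟨β, hβ, h1, h2⟩
    refine ⟨r • β, hβ.smul r, ?_, ?_⟩
    · rw [dC_smul]
      exact h1.smul r
    · rw [map_smul]
      exact h2.smul r

/-- The relation between cochains of constants and their values. -/
def constRel : Submodule ℝ (Cochain E M (p + 1) 0 × ((Fin (p + 1) → M) → ℝ)) where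
  carrier := {z | FormEqNear Set.univ z.1 (constC z.2)}
  zero_mem' := .of_eq isOpen_univ rfl
  add_mem' := fun h h' => FormEqNear.add h h'
  smul_mem' r _ h := FormEqNear.smul r h

/-- The relation between a form and the cochains of one point that are equal to it. -/
def formRel : Submodule ℝ (RawForm E M q × Cochain E M 1 q) where
  carrier := {z | FormEqNear Set.univ z.2 fun _ => z.1}
  zero_mem' := .of_eq isOpen_univ rfl
  add_mem' := fun h h' => FormEqNear.add h h'
  smul_mem' r _ h := FormEqNear.smul r h

variable {E M p q}

/-- A function of no points is a single form, so this coboundary is the augmentation that embeds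
forms into cochains of one point. -/
theorem coboundary_form_zero (θ : RawForm E M q) :
    coboundary (fun _ : Fin 0 → M => θ) = fun _ : Fin 1 → M => θ :=
  funext fun x => coboundary_zero_apply _ x

theorem formEqNear_const_iff (hU : IsOpen U) {θ η : RawForm E M q} :
    FormEqNear U (fun _ : Fin p → M => θ) (fun _ => η) ↔ ∀ x ∈ U, θ x = η x := by
  constructor
  · intro h x hx
    obtain ⟨V, -, hxV, -, hV⟩ := h x hx
    exact hV (fun _ => x) (fun _ => hxV) x hxV
  · exact fun h z hz => ⟨U, hU, hz, subset_rfl, fun _ _ => h⟩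

theorem smoothNear_const_iff [IsManifold 𝓘(ℝ, E) ∞ M] [FiniteDimensional ℝ E] (hU : IsOpen U)
    {θ : RawForm E M q} : SmoothNear U (fun _ : Fin p → M => θ) ↔ IsSmoothOn U θ := by
  constructor
  · intro h
    refine isSmoothOn_of_cover fun x hx => ?_
    obtain ⟨V, hV, hxV, -, hs⟩ := h x hx
    exact ⟨V, hV, hxV, hs (fun _ => x) fun _ => hxV⟩
  · exact fun h z hz => ⟨U, hU, hz, subset_rfl, fun _ _ => h⟩

theorem IsNullOn.congr : ∀ {q : ℕ} {α β : Cochain E M (p + 1) q},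
    IsNullOn U α → FormEqNear U α β → IsNullOn U β
  | 0, _, _, ⟨c, hc, hc'⟩, h => ⟨c, hc, h.symm.trans hc'⟩
  | _ + 1, _, _, ⟨c, hc, hc'⟩, h => ⟨c, hc, h.symm.trans hc'⟩

/-- A `β` depending on no points is a form `ν`, and `dC (coboundary β)` is the constant cochain `d
ν`. In degree `0` both sides mean vanishing on `U`. -/
theorem isNullOn_const_iff [IsManifold 𝓘(ℝ, E) ∞ M] [FiniteDimensional ℝ E] (hU : IsOpen U) :
    ∀ {q : ℕ} {θ : RawForm E M q}, IsNullOn U (fun _ : Fin 1 → M => θ) ↔ IsExactOn U θ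
  | 0, θ => by
    constructor
    · rintro ⟨c, hc, hθ⟩
      exact (formEqNear_const_iff hU).1 (hθ.trans (EqNear.constC (E := E) hc))
    · exact fun h => ⟨0, .zero hU, (formEqNear_const_iff hU).2 h⟩
  | q + 1, θ => by
    constructor
    · rintro ⟨β, hβ, hθ⟩
      have hβ' : β = fun _ => β Fin.elim0 := funext fun x => congrArg β (Subsingleton.elim _ _)
      rw [hβ', coboundary_form_zero] at hθ
      rw [hβ'] at hβ
      exact ⟨β Fin.elim0, (smoothNear_const_iff hU).1 hβ,
        fun x hx => ((formEqNear_const_iff hU).1 hθ x hx).symm⟩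
    · rintro ⟨ν, hν, hθ⟩
      refine ⟨fun _ => ν, (smoothNear_const_iff hU).2 hν, ?_⟩
      rw [coboundary_form_zero]
      exact (formEqNear_const_iff hU).2 fun x hx => (hθ x hx).symm

theorem isCocycleOn_const_iff [IsManifold 𝓘(ℝ, E) ∞ M] [FiniteDimensional ℝ E]
    {θ : RawForm E M q} :
    IsCocycleOn Set.univ (fun _ : Fin 1 → M => θ) ↔ θ ∈ closedForms E M q := by
  constructor
  · intro h
    exact ⟨(smoothNear_const_iff isOpen_univ).1 h.1, funext fun x =>
      (formEqNear_const_iff (p := 1) isOpen_univ).1 h.2 x trivial⟩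
  · intro h
    refine ⟨(smoothNear_const_iff isOpen_univ).2 h.1, .of_eq isOpen_univ ?_,
      .of_eq isOpen_univ ?_⟩
    · exact funext fun _ => h.2
    -- A constant cochain of one point is itself a coboundary, hence a cocycle.
    · rw [← coboundary_form_zero, coboundary_coboundary]

theorem IsCocycleOn.congr {α β : Cochain E M p q} (hα : IsCocycleOn U α)
    (h : FormEqNear U α β) : IsCocycleOn U β :=
  ⟨hα.1.congr h, h.dC.symm.trans hα.2, h.coboundary.symm.trans hα.3⟩

variable [IsManifold 𝓘(ℝ, E) ∞ M] [FiniteDimensional ℝ E] [T2Space M]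

variable (E M p) in
theorem nonempty_mixed_equiv_spanier : Nonempty
    (MixedCohomologyAtInfinity E M p 0 ≃ₗ[ℝ] SpanierCohomologyAtInfinity M p) := by
  have key : ∀ {U : Set M} (_ : IsOpen U) {α : Cochain E M (p + 1) 0} {c : (Fin (p + 1) → M) → ℝ},
      FormEqNear U α (constC c) → (IsNullOn U α ↔ IsCoboundaryOn U c) := by
    intro U hU α c h
    refine ⟨?_, fun hc => ⟨c, hc, h⟩⟩
    rintro ⟨b, hb, hb'⟩
    exact hb.congr (EqNear.of_constC (E := E) (hb'.symm.trans h))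
  refine nonempty_quotient_equiv_of_relation _ _ _ _ (constRel E M p) ?_ ?_ ?_
  · rintro α ⟨hα, K, hK, hn⟩
    obtain ⟨c, hc⟩ := exists_constC_of_dC_eq_zero hα.1 hα.2
    have ho := hK.isClosed.isOpen_compl
    refine ⟨c, ⟨?_, K, hK, (key ho (hc.mono ho (Set.subset_univ _))).1 hn⟩, hc⟩
    refine EqNear.of_constC (E := E) ?_
    rw [← coboundary_constC]
    exact hc.coboundary.symm.trans hα.3
  · rintro c ⟨hc, K, hK, hn⟩
    have ho := hK.isClosed.isOpen_compl
    refine ⟨constC c, ⟨⟨smoothNear_constC isOpen_univ c, .of_eq isOpen_univ (dC_constC c), ?_⟩,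
      K, hK, (key ho (.of_eq ho rfl)).2 hn⟩, .of_eq isOpen_univ rfl⟩
    rw [coboundary_constC]
    exact EqNear.constC hc
  · rintro α - c - h
    exact key isOpen_univ h

/-! ### The zigzag through the double complex -/

variable [SecondCountableTopology M]

/-- If `α = dC (coboundary γ)`, then `β - coboundary γ` is closed and has the same coboundary as
`β`. It is some `dC ν`, or a cochain of constants when `q = 0`, and applying `coboundary` shows that
`α'` is trivial. -/
theorem IsNullOn.of_zigzag_left (hU : IsOpen U) {α : Cochain E M (p + 1) (q + 1)}
    {α' : Cochain E M (p + 2) q} {β : Cochain E M (p + 1) q} (hβ : SmoothNear U β)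
    (h : FormEqNear U (dC β) α) (h' : FormEqNear U (coboundary β) α') (hα : IsNullOn U α) :
    IsNullOn U α' := by
  obtain ⟨γ, hγ, hγα⟩ := hα
  have hs : SmoothNear U (β - coboundary γ) := hβ.sub hγ.coboundary
  have hd : FormEqNear U (dC (β - coboundary γ)) 0 := by
    have := (h.trans hγα).sub (FormEqNear.of_eq hU (Eq.refl (dC (coboundary γ))))
    rw [sub_self] at this
    exact (dC_sub hβ hγ.coboundary).trans this
  have hδ : coboundary β = coboundary (β - coboundary γ) := by
    rw [map_sub, coboundary_coboundary, sub_zero]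
  rw [hδ] at h'
  cases q with
  | zero =>
    obtain ⟨c, hc⟩ := exists_constC_of_dC_eq_zero hs hd
    refine ⟨coboundary c, ⟨c, .of_eq hU rfl⟩, ?_⟩
    rw [← coboundary_constC]
    exact h'.symm.trans hc.coboundary
  | succ q =>
    obtain ⟨ν, hν, hν'⟩ := exists_dC_eq hU hs hd
    exact ⟨ν, hν, h'.symm.trans (hν'.coboundary.symm.trans (dC_coboundary hν).symm)⟩

/-- Triviality of `α'` yields a closed `γ` with `coboundary γ = α'`. Then `β - γ` is a cocycle in
the point direction, hence some `coboundary ν`, and `α = dC (β - γ) = dC (coboundary ν)`. -/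
theorem IsNullOn.of_zigzag_right (hU : IsOpen U) {α : Cochain E M (p + 1) (q + 1)}
    {α' : Cochain E M (p + 2) q} {β : Cochain E M (p + 1) q} (hβ : SmoothNear U β)
    (h : FormEqNear U (dC β) α) (h' : FormEqNear U (coboundary β) α') (hα' : IsNullOn U α') :
    IsNullOn U α := by
  obtain ⟨γ, hγ, hdγ, hδγ⟩ : ∃ γ : Cochain E M (p + 1) q, SmoothNear U γ ∧
      FormEqNear U (dC γ) 0 ∧ FormEqNear U (coboundary γ) α' := by
    cases q with
    | zero =>
      obtain ⟨c, ⟨b, hb⟩, hc⟩ := hα'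
      refine ⟨constC b, smoothNear_constC hU b, .of_eq hU (dC_constC b), ?_⟩
      rw [coboundary_constC]
      exact (EqNear.constC (E := E) hb).symm.trans hc.symm
    | succ q =>
      obtain ⟨γ, hγ, hc⟩ := hα'
      exact ⟨dC γ, hγ.dC, dC_dC hγ, (dC_coboundary hγ).symm.trans hc.symm⟩
  have hδ : FormEqNear U (coboundary (β - γ)) 0 := by
    have := h'.sub hδγ
    rwa [sub_self, ← map_sub] at this
  obtain ⟨ν, hν, hν'⟩ := exists_coboundary_eq hU (hβ.sub hγ) hδ
  refine ⟨ν, hν, ?_⟩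
  have := h.sub hdγ
  rw [sub_zero] at this
  exact (this.symm.trans (dC_sub hβ hγ).symm).trans hν'.dC.symm

theorem IsCocycleOn.exists_zigzag_left (hU : IsOpen U) {α : Cochain E M (p + 1) (q + 1)}
    (hα : IsCocycleOn U α) : ∃ β : Cochain E M (p + 1) q, SmoothNear U β ∧
      FormEqNear U (dC β) α ∧ IsCocycleOn U (coboundary β) := by
  obtain ⟨β, hβ, h⟩ := exists_dC_eq hU hα.1 hα.2
  exact ⟨β, hβ, h, hβ.coboundary, (dC_coboundary hβ).trans (h.coboundary.trans hα.3),
    .of_eq hU (coboundary_coboundary β)⟩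

theorem IsCocycleOn.exists_zigzag_right (hU : IsOpen U) {α : Cochain E M (p + 2) q}
    (hα : IsCocycleOn U α) : ∃ β : Cochain E M (p + 1) q, SmoothNear U β ∧
      FormEqNear U (coboundary β) α ∧ IsCocycleOn U (dC β) := by
  obtain ⟨β, hβ, h⟩ := exists_coboundary_eq hU hα.1 hα.3
  exact ⟨β, hβ, h, hβ.dC, dC_dC hβ, (dC_coboundary hβ).symm.trans (h.dC.trans hα.2)⟩

variable (E M p q)

/-- The cochain `β` linking the two sides is found globally; restricting it to `Kᶜ` transports
triviality there. -/
theorem nonempty_mixed_equiv_mixed : Nonempty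
    (MixedCohomologyAtInfinity E M p (q + 1) ≃ₗ[ℝ] MixedCohomologyAtInfinity E M (p + 1) q) := by
  refine nonempty_quotient_equiv_of_relation _ _ _ _ (zigzag E M p q) ?_ ?_ ?_
  · rintro α ⟨hα, K, hK, hn⟩
    obtain ⟨β, hβ, h, hc⟩ := hα.exists_zigzag_left isOpen_univ
    have ho := hK.isClosed.isOpen_compl
    have hsub := Set.subset_univ Kᶜ
    exact ⟨coboundary β, ⟨hc, K, hK, hn.of_zigzag_left ho (hβ.mono ho hsub) (h.mono ho hsub)
      (.of_eq ho rfl)⟩, β, hβ, h, .of_eq isOpen_univ rfl⟩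
  · rintro α ⟨hα, K, hK, hn⟩
    obtain ⟨β, hβ, h, hc⟩ := hα.exists_zigzag_right isOpen_univ
    have ho := hK.isClosed.isOpen_compl
    have hsub := Set.subset_univ Kᶜ
    exact ⟨dC β, ⟨hc, K, hK, hn.of_zigzag_right ho (hβ.mono ho hsub) (.of_eq ho rfl)
      (h.mono ho hsub)⟩, β, hβ, .of_eq isOpen_univ rfl, h⟩
  · rintro α - α' - ⟨β, hβ, h, h'⟩
    exact ⟨.of_zigzag_left isOpen_univ hβ h h', .of_zigzag_right isOpen_univ hβ h h'⟩

theorem nonempty_deRham_equiv_mixed : Nonempty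
    (CohomologyExactAtInfinity E M q ≃ₗ[ℝ] MixedCohomologyAtInfinity E M 0 q) := by
  have key : ∀ {U : Set M} (_ : IsOpen U) {θ : RawForm E M q} {α : Cochain E M 1 q},
      FormEqNear U α (fun _ => θ) → (IsExactOn U θ ↔ IsNullOn U α) := by
    intro U hU θ α h
    rw [← isNullOn_const_iff hU]
    exact ⟨fun hn => hn.congr h.symm, fun hn => hn.congr h⟩
  refine nonempty_quotient_equiv_of_relation _ _ _ _ (formRel E M q) ?_ ?_ ?_
  · rintro θ ⟨hθ, K, hK, hn⟩
    have ho := hK.isClosed.isOpen_compl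
    exact ⟨fun _ => θ, ⟨isCocycleOn_const_iff.2 hθ, K, hK, (key ho (.of_eq ho rfl)).1 hn⟩,
      .of_eq isOpen_univ rfl⟩
  · rintro α ⟨hα, K, hK, hn⟩
    have ho := hK.isClosed.isOpen_compl
    -- Exactness at one point glues the forms `α x` into a single global form.
    obtain ⟨β, -, h⟩ := exists_coboundary_eq isOpen_univ hα.1 hα.3
    have hβ : β = fun _ => β Fin.elim0 := funext fun x => congrArg β (Subsingleton.elim _ _)
    rw [hβ, coboundary_form_zero] at h
    exact ⟨β Fin.elim0, ⟨isCocycleOn_const_iff.1 (hα.congr h.symm), K, hK,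
      (key ho (h.symm.mono ho (Set.subset_univ _))).2 hn⟩, h.symm⟩
  · rintro θ - α - h
    exact key isOpen_univ h

/-- Each zigzag step trades one form degree for one more point, until only constants remain. -/
theorem nonempty_mixed_equiv_spanier_add : Nonempty
    (MixedCohomologyAtInfinity E M p q ≃ₗ[ℝ] SpanierCohomologyAtInfinity M (p + q)) := by
  induction q generalizing p with
  | zero => exact nonempty_mixed_equiv_spanier E M p
  | succ q ih =>
    obtain ⟨e⟩ := nonempty_mixed_equiv_mixed E M p q
    obtain ⟨f⟩ := ih (p + 1)
    rw [show p + (q + 1) = p + 1 + q by omega]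
    exact ⟨e ≪≫ₗ f⟩

/-- De Rham cohomology classes that are trivial at infinity, in terms of Alexander–Spanier
cohomology. -/
theorem nonempty_deRham_equiv_spanier : Nonempty
    (CohomologyExactAtInfinity E M q ≃ₗ[ℝ] SpanierCohomologyAtInfinity M q) := by
  obtain ⟨e⟩ := nonempty_deRham_equiv_mixed E M q
  obtain ⟨e'⟩ := nonempty_mixed_equiv_spanier_add E M 0 q
  rw [zero_add] at e'
  exact ⟨e ≪≫ₗ e'⟩

end DiffForm

namespace DiffForm

/-! ### Topological invariance -/

section Homeomorph

variable {X Y : Type*} [TopologicalSpace X] [TopologicalSpace Y] {p : ℕ}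

/-- Pullback of functions of `p` points. -/
def pullbackCochain {A : Type*} (h : X → Y) (f : (Fin p → Y) → A) : (Fin p → X) → A :=
  fun x => f (h ∘ x)

theorem EqNear.pullback {A : Type*} (h : X ≃ₜ Y) {U : Set Y} {f g : (Fin p → Y) → A}
    (hfg : EqNear U f g) :
    EqNear (h ⁻¹' U) (pullbackCochain h f) (pullbackCochain h g) := by
  intro z hz
  obtain ⟨V, hV, hzV, hVU, hx⟩ := hfg (h z) hz
  exact ⟨h ⁻¹' V, hV.preimage h.continuous, hzV, Set.preimage_mono hVU,
    fun x hxV => hx (h ∘ x) hxV⟩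

theorem IsCoboundaryOn.pullback (h : X ≃ₜ Y) {U : Set Y} :
    ∀ {p : ℕ} {c : (Fin (p + 1) → Y) → ℝ}, IsCoboundaryOn U c →
      IsCoboundaryOn (h ⁻¹' U) (pullbackCochain h c)
  | 0, _, hc => EqNear.pullback h hc
  | _ + 1, _, ⟨b, hb⟩ => ⟨pullbackCochain h b, EqNear.pullback h hb⟩

variable [T2Space X] [T2Space Y]

/-- The compact set is pulled back too, and stays compact under a homeomorphism. -/
theorem pullbackCochain_mem (h : X ≃ₜ Y) {k : ℕ} {c : (Fin (k + 1) → Y) → ℝ}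
    (hc : c ∈ spanierCocyclesAtInfinity Y k) :
    pullbackCochain h c ∈ spanierCocyclesAtInfinity X k := by
  obtain ⟨hc, K, hK, hn⟩ := hc
  exact ⟨EqNear.pullback h hc, h ⁻¹' K, h.isCompact_preimage.2 hK, hn.pullback h⟩

theorem nonempty_spanier_equiv_of_homeomorph (h : X ≃ₜ Y) (k : ℕ) : Nonempty
    (SpanierCohomologyAtInfinity X k ≃ₗ[ℝ] SpanierCohomologyAtInfinity Y k) := by
  have hinv : ∀ c : (Fin (k + 1) → X) → ℝ, pullbackCochain h (pullbackCochain h.symm c) = c :=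
    fun c => funext fun x => congrArg c (funext fun i => h.symm_apply_apply (x i))
  have hinv' : ∀ c : (Fin (k + 1) → Y) → ℝ, pullbackCochain h.symm (pullbackCochain h c) = c :=
    fun c => funext fun x => congrArg c (funext fun i => h.apply_symm_apply (x i))
  let R : Submodule ℝ (((Fin (k + 1) → X) → ℝ) × ((Fin (k + 1) → Y) → ℝ)) :=
    { carrier := {z | z.1 = pullbackCochain h z.2}
      zero_mem' := rfl
      add_mem' := fun hz hz' => congrArg₂ (· + ·) hz hz'
      smul_mem' := fun r _ hz => congrArg (r • ·) hz }
  refine nonempty_quotient_equiv_of_relation _ _ _ _ R ?_ ?_ ?_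
  · exact fun c hc => ⟨pullbackCochain h.symm c, pullbackCochain_mem h.symm hc, (hinv c).symm⟩
  · exact fun c hc => ⟨pullbackCochain h c, pullbackCochain_mem h hc, rfl⟩
  · intro b _ c _ hbc
    obtain rfl : b = pullbackCochain h c := hbc
    constructor
    · intro hc
      have := IsCoboundaryOn.pullback h.symm hc
      rwa [hinv'] at this
    · exact fun hc => IsCoboundaryOn.pullback h hc

end Homeomorph

end DiffForm

theorem mainTheorem7 {m n : ℕ}
    (M : Type u) [TopologicalSpace M] [T2Space M] [SecondCountableTopology M]
    [ChartedSpace (EuclideanSpace ℝ (Fin m)) M]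
    [IsManifold 𝓘(ℝ, EuclideanSpace ℝ (Fin m)) ∞ M]
    (N : Type v) [TopologicalSpace N] [T2Space N] [SecondCountableTopology N]
    [ChartedSpace (EuclideanSpace ℝ (Fin n)) N]
    [IsManifold 𝓘(ℝ, EuclideanSpace ℝ (Fin n)) ∞ N]
    (h : Nonempty (M ≃ₜ N)) (k : ℕ) :
    Cardinal.lift.{v} (DiffForm.c (EuclideanSpace ℝ (Fin m)) M k) =
      Cardinal.lift.{u} (DiffForm.c (EuclideanSpace ℝ (Fin n)) N k) := by
  obtain ⟨h⟩ := h
  obtain ⟨e⟩ := DiffForm.nonempty_deRham_equiv_spanier (EuclideanSpace ℝ (Fin m)) M k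
  obtain ⟨e'⟩ := DiffForm.nonempty_spanier_equiv_of_homeomorph h k
  obtain ⟨e''⟩ := DiffForm.nonempty_deRham_equiv_spanier (EuclideanSpace ℝ (Fin n)) N k
  exact (e ≪≫ₗ e' ≪≫ₗ e''.symm).lift_rank_eq
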